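/- Let $N\ge 1$, $S^1=\mathbb R/2\pi\mathbb Z$ and $\mathbb T^{N+1}=S^1_t\times\mathbb T^N_x$. A function $q(t,\xi)$, $(t,\xi)\in S^1\times\mathbb Z^N$, is called a symbol of order $\mu\in\mathbb R$ if it is smooth in $t$ and for every $\alpha\in\mathbb Z_{\ge 0}$ there is $C_\alpha>0$ such that $|\partial_t^\alpha q(t,\xi)|\le C_\alpha(1+|\xi|)^\mu$ for all $t\in S^1$, $\xi\in\mathbb Z^N$. It is called positively homogeneous of degree $\mu$ if it is a symbol of order $\mu$ and $q(t,n\xi)=n^\mu q(t,\xi)$ for all $t\in S^1$, $\xi\in\mathbb Z^N$, $n\in\{1,2,3,\dots\}$. For a complex-valued symbol $c(t,\xi)$ of some order put $$c(t,D_x)u(t,x)=\sum_{\xi\in\mathbb Z^N}c(t,\xi)\,\hat u(t,\xi)\,e^{ix\xi},\qquad \hat u(t,\xi)=(2\pi)^{-N}\int_{[0,2\pi]^N}u(t,x)e^{-ix\xi}\,dx,$$ and $P=D_t+c(t,D_x)$, where $D_t=-i\partial_t$. The operator $P:C^\infty(\mathbb T^{N+1})\to C^\infty(\mathbb T^{N+1})$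 is called globally solvable if its range is closed in $C^\infty(\mathbb T^{N+1})$. **Proposition.** Let $c(t,\xi)$ be a symbol of some order $\mu\in\mathbb R$ whose imaginary part $b=\operatorname{Im}c$ has the form $b(t,\xi)=b_m(t,\xi)+b'(t,\xi)$, where $m>0$ is real, $b_m$ is real-valued and positively homogeneous of degree $m$, and $b'$ is a real-valued symbol of order $m'<m$. Suppose that there is $\xi_0\in\mathbb Z^N\setminus\{0\}$ such that 1. $(2\pi)^{-1}\int_0^{2\pi}b_m(t,\xi_0)\,dt\ne 0$; 2. $b_m(\cdot,\xi_0)$ changes sign, i.e. it takes both a negative and a positive value. Then $P=D_t+c(t,D_x)$ is not globally solvable. -/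

import Mathlib

open scoped ContDiff Topology

noncomputable section

namespace TorusPDO

/-- A smooth complex function on the torus `𝕋^{N+1} = S¹_t × 𝕋^N_x`, written as a smooth function
on `ℝ × ℝ^N` that is `2π`-periodic in each of the `N + 1` variables. -/
structure SmoothFun (N : ℕ) where
  toFun : ℝ × (Fin N → ℝ) → ℂ
  smooth : ContDiff ℝ ∞ toFun
  periodic : ∀ (k : ℤ) (l : Fin N → ℤ) (t : ℝ) (x : Fin N → ℝ),
    toFun (t + 2 * Real.pi * k, fun j => x j + 2 * Real.pi * l j) = toFun (t, x)

/-- The usual (Fréchet) topology of `C^∞(𝕋^{N+1})`: uniform convergence of the derivatives of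
every order. -/
instance (N : ℕ) : TopologicalSpace (SmoothFun N) :=
  ⨅ k : ℕ, TopologicalSpace.induced
    (fun f : SmoothFun N => UniformFun.ofFun (iteratedFDeriv ℝ k f.toFun)) inferInstance

/-- The Euclidean length `|ξ|` of a frequency `ξ ∈ ℤ^N`. -/
def freqNorm {N : ℕ} (ξ : Fin N → ℤ) : ℝ :=
  Real.sqrt (∑ j, (ξ j : ℝ) ^ 2)

/-- The character `x ↦ e^{i x ξ}` of `𝕋^N`. -/
def character {N : ℕ} (ξ : Fin N → ℤ) (x : Fin N → ℝ) : ℂ :=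
  Complex.exp (Complex.I * ((∑ j, x j * (ξ j : ℝ) : ℝ) : ℂ))

/-- The partial Fourier transform in `x`:
`û(t, ξ) = (2π)^{-N} ∫_{[0,2π]^N} u(t, x) e^{-i x ξ} dx`. -/
def partialFourier {N : ℕ} (u : ℝ × (Fin N → ℝ) → ℂ) (t : ℝ) (ξ : Fin N → ℤ) : ℂ :=
  (((2 * Real.pi) ^ N)⁻¹ : ℝ) *
    ∫ x in Set.Icc (0 : Fin N → ℝ) (fun _ => 2 * Real.pi), u (t, x) * character (-ξ) x

/-- `c(t, ξ)` is a tube type symbol of order `m`: a `2π`-periodic smooth function of `t` with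
`|∂_t^α c(t, ξ)| ≤ C_α (1 + |ξ|)^m` for all `α`, `t` and `ξ ∈ ℤ^N`. -/
structure IsSymbol {N : ℕ} {E : Type*} [NormedAddCommGroup E] [NormedSpace ℝ E]
    (m : ℝ) (c : ℝ → (Fin N → ℤ) → E) : Prop where
  smooth : ∀ ξ, ContDiff ℝ ∞ (fun t => c t ξ)
  periodic : ∀ t ξ, c (t + 2 * Real.pi) ξ = c t ξ
  bound : ∀ α : ℕ, ∃ C : ℝ, 0 < C ∧ ∀ t ξ,
    ‖iteratedDeriv α (fun s => c s ξ) t‖ ≤ C * (1 + freqNorm ξ) ^ m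

/-- `b` is positively homogeneous of degree `m`: it has order `m` and
`b(t, n ξ) = n^m b(t, ξ)` for `n = 1, 2, 3, …`. -/
structure IsPositivelyHomogeneous {N : ℕ} (m : ℝ) (b : ℝ → (Fin N → ℤ) → ℝ) : Prop where
  isSymbol : IsSymbol m b
  homogeneous : ∀ (n : ℕ), 1 ≤ n → ∀ t ξ, b t ((n : ℤ) • ξ) = (n : ℝ) ^ m * b t ξ

/-- The operator `c(t, D_x)` with discrete symbol `c(t, ξ)`:
`c(t, D_x) u (t, x) = ∑_ξ c(t, ξ) û(t, ξ) e^{i x ξ}`. -/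
def pseudoDiff {N : ℕ} (c : ℝ → (Fin N → ℤ) → ℂ) (u : ℝ × (Fin N → ℝ) → ℂ) :
    ℝ × (Fin N → ℝ) → ℂ :=
  fun p => ∑' ξ : Fin N → ℤ, c p.1 ξ * partialFourier u p.1 ξ * character ξ p.2

/-- The operator `P = D_t + c(t, D_x)`, where `D_t = -i ∂_t`. -/
def operatorP {N : ℕ} (c : ℝ → (Fin N → ℤ) → ℂ) (u : ℝ × (Fin N → ℝ) → ℂ) :
    ℝ × (Fin N → ℝ) → ℂ :=
  fun p => -Complex.I * deriv (fun s => u (s, p.2)) p.1 + pseudoDiff c u p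

/-- The range of `P = D_t + c(t, D_x)` acting on `C^∞(𝕋^{N+1})`. -/
def rangeP {N : ℕ} (c : ℝ → (Fin N → ℤ) → ℂ) : Set (SmoothFun N) :=
  {f | ∃ u : SmoothFun N, operatorP c u.toFun = f.toFun}

/-- `P = D_t + c(t, D_x)` is globally solvable: its range is closed in `C^∞(𝕋^{N+1})`. -/
def IsGloballySolvable {N : ℕ} (c : ℝ → (Fin N → ℤ) → ℂ) : Prop :=
  IsClosed (rangeP c)

/-- A real function changes sign: it takes a negative and a positive value. -/
def ChangesSign (g : ℝ → ℝ) : Prop :=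
  (∃ t, g t < 0) ∧ ∃ t, 0 < g t

end TorusPDO

end

noncomputable section

namespace TorusPDO

/-! ### Fourier analysis of smooth periodic functions on `ℝ^N`. -/

section FourierCoefficients

variable {N : ℕ}

/-! Restricted to the frequencies `(n + 1) ξ₀`, the operator becomes the family of periodic ODEs `-i
a_n' + c a_n = f_n`. A homogeneous solution is `exp(-i ∫ c)`, of modulus `exp(∫ b)`, and to leading
order `∫ b` is `(n + 1)^m` times a primitive of `b_m(·, ξ₀)`. Since `b_m(·, ξ₀)` passes from
positive to negative, this primitive has an interior peak `t₀` and is lower by a fixed `ε` on both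
sides (`exists_peak`).

Cut the homogeneous solution, normalised at `t₀` and multiplied by `n + 1`, with `χ` equal to `1`
around the peak and with `χ'` living only where the primitive is lower. Then `a_n(t₀) = n + 1`,
while `f_n`, which contains `χ'`, is of size `exp(-ε (n + 1)^m)` up to lower order factors
(`exists_amplitudes`). So `f = ∑ f_n e^{i(n+1)xξ₀}` is smooth and its partial sums lie in the range
(`operatorP_partialSum`, `tendsto_partialSum`).

If the range were closed, then `f = P u` with `u` smooth. For large `n` the mean of `Im c` at `(n +
1) ξ₀` is nonzero (`eventually_mean_im_ne_zero`), so the periodic ODE has only one solution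
(`eq_zero_of_periodic`) and `û(t₀, (n + 1) ξ₀) = a_n(t₀) = n + 1`. This contradicts the boundedness
of the Fourier coefficients of `u(t₀, ·)`. -/

lemma character_zero (x : Fin N → ℝ) : character 0 x = 1 := by
  simp [character]

lemma character_add (ξ η : Fin N → ℤ) (x : Fin N → ℝ) :
    character (ξ + η) x = character ξ x * character η x := by
  simp only [character, ← Complex.exp_add, ← mul_add, ← Complex.ofReal_add,
    ← Finset.sum_add_distrib, Pi.add_apply, Int.cast_add]

lemma norm_character (ξ : Fin N → ℤ) (x : Fin N → ℝ) : ‖character ξ x‖ = 1 := by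
  rw [character, mul_comm, Complex.norm_exp_ofReal_mul_I]

lemma character_periodic (ξ l : Fin N → ℤ) (x : Fin N → ℝ) :
    character ξ (fun j => x j + 2 * Real.pi * l j) = character ξ x := by
  have h : Complex.I * ((∑ j, (x j + 2 * Real.pi * l j) * (ξ j : ℝ) : ℝ) : ℂ)
      = Complex.I * ((∑ j, x j * (ξ j : ℝ) : ℝ) : ℂ)
        + ((∑ j, l j * ξ j : ℤ) : ℂ) * (2 * Real.pi * Complex.I) := by
    push_cast
    rw [Finset.sum_mul, Finset.mul_sum, Finset.mul_sum, ← Finset.sum_add_distrib]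
    exact Finset.sum_congr rfl fun j _ => by ring
  rw [character, h, Complex.exp_add, Complex.exp_int_mul_two_pi_mul_I, mul_one, character]

/-- The linear form `x ↦ x ξ` on `ℝ^N`. -/
def phase (ξ : Fin N → ℤ) : (Fin N → ℝ) →L[ℝ] ℝ :=
  ∑ j, (ξ j : ℝ) • ContinuousLinearMap.proj j

lemma phase_apply (ξ : Fin N → ℤ) (x : Fin N → ℝ) : phase ξ x = ∑ j, x j * (ξ j : ℝ) := by
  simp [phase, mul_comm]

lemma phase_single (ξ : Fin N → ℤ) (j : Fin N) : phase ξ (Pi.single j 1) = ξ j := by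
  rw [phase_apply, Finset.sum_eq_single j] <;> simp +contextual

lemma character_eq (ξ : Fin N → ℤ) (x : Fin N → ℝ) :
    character ξ x = Complex.exp (Complex.I * (phase ξ x : ℂ)) := by
  rw [character, phase_apply]

lemma contDiff_character (ξ : Fin N → ℤ) : ContDiff ℝ ∞ (character ξ) := by
  rw [funext (character_eq ξ)]
  exact (contDiff_const.mul (Complex.ofRealCLM.contDiff.comp (phase ξ).contDiff)).cexp

lemma fderiv_character_single (ξ : Fin N → ℤ) (x : Fin N → ℝ) (j : Fin N) :
    fderiv ℝ (character ξ) x (Pi.single j 1) = Complex.I * ξ j * character ξ x := by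
  have h : HasFDerivAt (fun x => Complex.I * (phase ξ x : ℂ))
      (Complex.I • (Complex.ofRealCLM.comp (phase ξ))) x :=
    (Complex.ofRealCLM.hasFDerivAt.comp x (phase ξ).hasFDerivAt).const_mul _
  rw [funext (character_eq ξ), h.cexp.fderiv]
  simp [phase_single]
  ring

/-- Smooth functions on `ℝ^N` that are `2π`-periodic in each variable. -/
def SmoothPeriodic (g : (Fin N → ℝ) → ℂ) : Prop :=
  ContDiff ℝ ∞ g ∧ ∀ (l : Fin N → ℤ) x, g (fun j => x j + 2 * Real.pi * l j) = g x

/-- The fundamental box `[0, 2π]^N`. -/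
abbrev box (N : ℕ) : Set (Fin N → ℝ) := Set.Icc (0 : Fin N → ℝ) (fun _ => 2 * Real.pi)

/-- The Fourier coefficients of a function on `ℝ^N`, computed on `[0, 2π]^N`. -/
def fourierCoef (g : (Fin N → ℝ) → ℂ) (ξ : Fin N → ℤ) : ℂ :=
  (((2 * Real.pi) ^ N)⁻¹ : ℝ) * ∫ x in box N, g x * character (-ξ) x

lemma partialFourier_eq (u : ℝ × (Fin N → ℝ) → ℂ) (t : ℝ) (ξ : Fin N → ℤ) :
    partialFourier u t ξ = fourierCoef (fun x => u (t, x)) ξ := rfl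

lemma smoothPeriodic_character (ξ : Fin N → ℤ) : SmoothPeriodic (character ξ) :=
  ⟨contDiff_character ξ, fun l x => character_periodic ξ l x⟩

lemma SmoothPeriodic.mul {g h : (Fin N → ℝ) → ℂ} (hg : SmoothPeriodic g)
    (hh : SmoothPeriodic h) : SmoothPeriodic (fun x => g x * h x) :=
  ⟨hg.1.mul hh.1, fun l x => congrArg₂ _ (hg.2 l x) (hh.2 l x)⟩

lemma SmoothPeriodic.fderiv_apply {g : (Fin N → ℝ) → ℂ} (hg : SmoothPeriodic g)
    (v : Fin N → ℝ) : SmoothPeriodic (fun x => fderiv ℝ g x v) := by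
  refine ⟨(hg.1.fderiv_right (m := ∞) (by simp)).clm_apply contDiff_const, fun l x => ?_⟩
  have h : g = fun y => g (y + fun j => 2 * Real.pi * l j) := by
    funext y
    exact (hg.2 l y).symm
  have h' := fderiv_comp_add_right (𝕜 := ℝ) (f := g) (x := x) fun j => 2 * Real.pi * (l j : ℝ)
  rw [← h] at h'
  exact (DFunLike.congr_fun h' v).symm

lemma SmoothFun.smoothPeriodic (u : SmoothFun N) (t : ℝ) :
    SmoothPeriodic (fun x => u.toFun (t, x)) :=
  ⟨u.smooth.comp (contDiff_const.prodMk contDiff_id), fun l x => by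
    simpa using u.periodic 0 l t x⟩

lemma SmoothPeriodic.exists_bound {g : (Fin N → ℝ) → ℂ} (hg : SmoothPeriodic g) :
    ∃ C, ∀ x, ‖g x‖ ≤ C := by
  obtain ⟨C, hC⟩ := (isCompact_Icc (a := (0 : Fin N → ℝ)) (b := fun _ => 2 * Real.pi)
    ).exists_bound_of_continuousOn hg.1.continuous.continuousOn
  refine ⟨C, fun x => ?_⟩
  -- Translate `x` into the fundamental box, coordinate by coordinate.
  rw [← hg.2 (fun j => -⌊x j / (2 * Real.pi)⌋) x]
  have hp := Real.two_pi_pos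
  have hx (j : Fin N) : x j = 2 * Real.pi * (x j / (2 * Real.pi)) := by field_simp
  refine hC _ ⟨fun j => ?_, fun j => ?_⟩
  · have := mul_le_mul_of_nonneg_left (Int.floor_le (x j / (2 * Real.pi))) hp.le
    simp only [Pi.zero_apply]
    push_cast
    linarith [hx j]
  · have := mul_le_mul_of_nonneg_left (Int.lt_floor_add_one (x j / (2 * Real.pi))).le hp.le
    simp only
    push_cast
    linarith [hx j]

lemma volume_real_box : MeasureTheory.volume.real (box N) = (2 * Real.pi) ^ N := by
  rw [MeasureTheory.measureReal_def, Real.volume_Icc_pi_toReal]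
  · simp
  · exact fun _ => Real.two_pi_pos.le

lemma norm_fourierCoef_le {g : (Fin N → ℝ) → ℂ} {C : ℝ} (hg : ∀ x, ‖g x‖ ≤ C)
    (ξ : Fin N → ℤ) : ‖fourierCoef g ξ‖ ≤ C := by
  have h : ‖∫ x in box N, g x * character (-ξ) x‖ ≤ C * (2 * Real.pi) ^ N := by
    rw [← volume_real_box]
    refine MeasureTheory.norm_setIntegral_le_of_norm_le_const isCompact_Icc.measure_lt_top
      fun x _ => ?_
    rw [norm_mul, norm_character, mul_one]
    exact hg x
  have hp : 0 < (2 * Real.pi) ^ N := pow_pos Real.two_pi_pos N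
  rw [fourierCoef, norm_mul, Complex.norm_real, norm_inv, Real.norm_of_nonneg hp.le,
    inv_mul_le_iff₀ hp, mul_comm]
  exact h

/-- Divergence theorem for the field whose only component is `F` in direction `j`: by periodicity
the contributions of opposite faces cancel. -/
lemma SmoothPeriodic.integral_fderiv_single {F : (Fin N → ℝ) → ℂ} (hF : SmoothPeriodic F)
    (j : Fin N) : ∫ x in box N, fderiv ℝ F x (Pi.single j 1) = 0 := by
  obtain _ | n := N
  · exact j.elim0
  have hd : ∀ x, HasFDerivAt F (fderiv ℝ F x) x := fun x =>
    (hF.1.differentiable (by simp) x).hasFDerivAt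
  have key := MeasureTheory.integral_divergence_of_hasFDerivAt_off_countable'
    (0 : Fin (n + 1) → ℝ) (fun _ => 2 * Real.pi) (fun _ => Real.two_pi_pos.le)
    (fun i x => if i = j then F x else 0) (fun i x => if i = j then fderiv ℝ F x else 0)
    ∅ Set.countable_empty
    (fun i => by
      split_ifs
      · exact hF.1.continuous.continuousOn
      · exact continuousOn_const)
    (fun x _ i => by
      split_ifs
      · exact hd x
      · exact hasFDerivAt_const _ _)
    (by
      refine ContinuousOn.integrableOn_compact isCompact_Icc (Continuous.continuousOn ?_)
      refine continuous_finsetSum _ fun i _ => ?_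
      split_ifs
      · exact (hF.fderiv_apply _).1.continuous
      · simpa using continuous_const)
  have h1 (x : Fin (n + 1) → ℝ) :
      ∑ i, (if i = j then fderiv ℝ F x else 0) (Pi.single i 1)
        = fderiv ℝ F x (Pi.single j 1) := by
    rw [Finset.sum_eq_single j] <;> simp +contextual
  simp only [h1] at key
  rw [key]
  refine Finset.sum_eq_zero fun i _ => ?_
  rw [sub_eq_zero]
  congr 1
  funext x
  split_ifs with hij
  · rw [← hF.2 (Pi.single i 1) (i.insertNth ((0 : Fin (n + 1) → ℝ) i) x)]
    congr 1
    funext k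
    refine Fin.succAboveCases i ?_ (fun k => ?_) k
    · simp
    · simp
  · rfl

/-- Integration by parts: the derivative of `g * character (-ξ)` integrates to zero over the box. -/
lemma SmoothPeriodic.fourierCoef_fderiv_single {g : (Fin N → ℝ) → ℂ} (hg : SmoothPeriodic g)
    (j : Fin N) (ξ : Fin N → ℤ) :
    fourierCoef (fun x => fderiv ℝ g x (Pi.single j 1)) ξ
      = Complex.I * ξ j * fourierCoef g ξ := by
  have hc := smoothPeriodic_character (-ξ)
  have h0 := (hg.mul hc).integral_fderiv_single j
  have h1 (x : Fin N → ℝ) : fderiv ℝ (fun x => g x * character (-ξ) x) x (Pi.single j 1)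
      = fderiv ℝ g x (Pi.single j 1) * character (-ξ) x
        - Complex.I * ξ j * (g x * character (-ξ) x) := by
    rw [fderiv_fun_mul (hg.1.differentiable (by simp) x) (hc.1.differentiable (by simp) x)]
    simp [fderiv_character_single]
    ring
  have hi {h : (Fin N → ℝ) → ℂ} (hh : SmoothPeriodic h) :
      MeasureTheory.IntegrableOn h (box N) :=
    hh.1.continuous.continuousOn.integrableOn_compact isCompact_Icc
  simp only [h1] at h0
  rw [MeasureTheory.integral_sub (hi ((hg.fderiv_apply _).mul hc)) ((hi (hg.mul hc)).const_mul _),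
    MeasureTheory.integral_const_mul, sub_eq_zero] at h0
  rw [fourierCoef, fourierCoef, h0]
  ring

lemma SmoothPeriodic.exists_abs_pow_mul_fourierCoef_le {g : (Fin N → ℝ) → ℂ}
    (hg : SmoothPeriodic g) (j : Fin N) (K : ℕ) :
    ∃ C, ∀ ξ : Fin N → ℤ, |(ξ j : ℝ)| ^ K * ‖fourierCoef g ξ‖ ≤ C := by
  induction K generalizing g with
  | zero =>
    obtain ⟨C, hC⟩ := hg.exists_bound
    exact ⟨C, fun ξ => by simpa using norm_fourierCoef_le hC ξ⟩
  | succ K ih =>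
    obtain ⟨C, hC⟩ := ih (hg.fderiv_apply (Pi.single j 1))
    refine ⟨C, fun ξ => (le_of_eq ?_).trans (hC ξ)⟩
    rw [hg.fourierCoef_fderiv_single, norm_mul, norm_mul, Complex.norm_I, one_mul,
      Complex.norm_intCast, pow_succ, mul_assoc]

lemma SmoothPeriodic.exists_one_add_norm_pow_mul_fourierCoef_le {g : (Fin N → ℝ) → ℂ}
    (hg : SmoothPeriodic g) (K : ℕ) :
    ∃ C, ∀ ξ : Fin N → ℤ, (1 + ‖ξ‖) ^ K * ‖fourierCoef g ξ‖ ≤ C := by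
  obtain ⟨C₀, hC₀⟩ := hg.exists_bound
  choose C hC using fun j => hg.exists_abs_pow_mul_fourierCoef_le j K
  refine ⟨2 ^ K * (2 * C₀ + ∑ j, C j), fun ξ => ?_⟩
  have h0 := norm_fourierCoef_le hC₀ ξ
  -- The sup norm is attained at a coordinate; the summand `1` is there for `N = 0`, where the sum
  -- is empty and `0 ^ 0 = 1` may occur.
  have hs : ‖ξ‖ ^ K ≤ 1 + ∑ j, |(ξ j : ℝ)| ^ K := by
    by_cases hN : Nonempty (Fin N)
    · obtain ⟨j, hj⟩ : ∃ j, ‖ξ‖ = ‖ξ j‖ := by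
        obtain ⟨j, hj⟩ := Finite.exists_max fun j => ‖ξ j‖
        exact ⟨j, le_antisymm ((pi_norm_le_iff_of_nonneg (norm_nonneg _)).2 hj)
          (norm_le_pi_norm ξ j)⟩
      rw [hj, Int.norm_eq_abs]
      have := Finset.single_le_sum (f := fun j => |(ξ j : ℝ)| ^ K)
        (fun i _ => by positivity) (Finset.mem_univ j)
      linarith
    · rw [not_nonempty_iff] at hN
      rw [Subsingleton.elim ξ 0]
      simpa using pow_le_one₀ (n := K) le_rfl zero_le_one
  have h2 : (1 + ‖ξ‖) ^ K ≤ 2 ^ K * (1 + ‖ξ‖ ^ K) := by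
    have := add_pow_le (zero_le_one (α := ℝ)) (norm_nonneg ξ) K
    rw [one_pow] at this
    refine this.trans (mul_le_mul_of_nonneg_right ?_ (by positivity))
    exact pow_le_pow_right₀ one_le_two (Nat.sub_le _ _)
  calc (1 + ‖ξ‖) ^ K * ‖fourierCoef g ξ‖
      ≤ 2 ^ K * (1 + (1 + ∑ j, |(ξ j : ℝ)| ^ K)) * ‖fourierCoef g ξ‖ := by
        gcongr
        exact h2.trans (by gcongr)
    _ = 2 ^ K * (2 * ‖fourierCoef g ξ‖ + ∑ j, |(ξ j : ℝ)| ^ K * ‖fourierCoef g ξ‖) := by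
        rw [← Finset.sum_mul]; ring
    _ ≤ _ := by
        gcongr with j
        exact hC j ξ

lemma summable_prod_pi {g : ℤ → ℝ} (hg : Summable g) (h0 : ∀ k, 0 ≤ g k) (N : ℕ) :
    Summable fun ξ : Fin N → ℤ => ∏ j, g (ξ j) := by
  induction N with
  | zero => exact (hasSum_fintype _).summable
  | succ n ih =>
    rw [← (Fin.consEquiv fun _ => ℤ).summable_iff]
    have := hg.mul_of_nonneg ih h0 fun ξ => Finset.prod_nonneg fun j _ => h0 _
    refine this.congr fun p => ?_
    simp [Fin.prod_univ_succ, Fin.consEquiv]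

/-- With exponent `2 * N` the weight is dominated by a product of `N` summable one-dimensional
factors `(1 + |ξ_j|)^(-2)`. -/
lemma summable_one_add_norm_pow_inv (N : ℕ) :
    Summable fun ξ : Fin N → ℤ => ((1 + ‖ξ‖) ^ (2 * N))⁻¹ := by
  have hg : Summable fun k : ℤ => ((1 + ‖k‖) ^ 2)⁻¹ := by
    have h1 : Summable fun k : ℤ => ((k : ℝ) ^ 2)⁻¹ := by
      simpa using (Real.summable_one_div_int_pow (p := 2)).2 one_lt_two
    have h2 : Summable fun k : ℤ => (if k = 0 then (1 : ℝ) else 0) :=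
      summable_of_ne_finset_zero (s := {0}) fun k hk => by simpa using hk
    refine Summable.of_nonneg_of_le (fun k => by positivity) (fun k => ?_) (h1.add h2)
    by_cases hk : k = 0
    · simp [hk]
    · have : 0 < ((k : ℝ) ^ 2) := by positivity
      simp only [hk, if_false, add_zero]
      refine inv_anti₀ this ?_
      rw [← sq_abs, Int.norm_eq_abs]
      gcongr
      linarith
  refine Summable.of_nonneg_of_le (fun ξ => by positivity) (fun ξ => ?_)
    (summable_prod_pi hg (fun k => by positivity) N)
  rw [Finset.prod_inv_distrib]
  refine inv_anti₀ (Finset.prod_pos fun j _ => by positivity) ?_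
  calc ∏ j, (1 + ‖ξ j‖) ^ 2 ≤ ∏ _j : Fin N, (1 + ‖ξ‖) ^ 2 :=
        Finset.prod_le_prod (fun j _ => by positivity) fun j _ => by
          gcongr
          exact norm_le_pi_norm ξ j
    _ = (1 + ‖ξ‖) ^ (2 * N) := by simp [pow_mul]

lemma freqNorm_nonneg (ξ : Fin N → ℤ) : 0 ≤ freqNorm ξ := Real.sqrt_nonneg _

lemma freqNorm_le (ξ : Fin N → ℤ) : freqNorm ξ ≤ N * ‖ξ‖ := by
  refine Real.sqrt_le_iff.2 ⟨by positivity, ?_⟩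
  calc ∑ j, (ξ j : ℝ) ^ 2 ≤ ∑ _j : Fin N, ‖ξ‖ ^ 2 := Finset.sum_le_sum fun j _ => by
        rw [← sq_abs, ← Int.norm_eq_abs]
        gcongr
        exact norm_le_pi_norm ξ j
    _ = N * ‖ξ‖ ^ 2 := by simp
    _ ≤ (N : ℝ) ^ 2 * ‖ξ‖ ^ 2 := by
        gcongr
        exact_mod_cast Nat.le_self_pow two_ne_zero N
    _ = _ := by ring

/-- Coefficients of smooth functions decay faster than any symbol grows, so the series defining
`pseudoDiff` converges absolutely and its Fourier coefficients can be read off termwise. -/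
lemma IsSymbol.summable_mul_fourierCoef {μ : ℝ} {c : ℝ → (Fin N → ℤ) → ℂ} (hc : IsSymbol μ c)
    {g : (Fin N → ℝ) → ℂ} (hg : SmoothPeriodic g) (t : ℝ) :
    Summable fun ξ => ‖c t ξ * fourierCoef g ξ‖ := by
  obtain ⟨C, hC0, hC⟩ := hc.bound 0
  obtain ⟨p, hp⟩ := exists_nat_ge μ
  obtain ⟨D, hD⟩ := hg.exists_one_add_norm_pow_mul_fourierCoef_le (p + 2 * N)
  refine Summable.of_nonneg_of_le (fun ξ => norm_nonneg _) (fun ξ => ?_)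
    ((summable_one_add_norm_pow_inv N).mul_left (C * (1 + N) ^ p * D))
  have h1 : ‖c t ξ‖ ≤ C * ((1 + N) ^ p * (1 + ‖ξ‖) ^ p) := by
    have h := hC t ξ
    simp only [iteratedDeriv_zero] at h
    refine h.trans ?_
    gcongr
    have h1 : 1 ≤ 1 + freqNorm ξ := by linarith [freqNorm_nonneg ξ]
    calc (1 + freqNorm ξ) ^ μ ≤ (1 + freqNorm ξ) ^ (p : ℝ) := Real.rpow_le_rpow_of_exponent_le h1 hp
      _ = (1 + freqNorm ξ) ^ p := Real.rpow_natCast _ _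
      _ ≤ ((1 + N) * (1 + ‖ξ‖)) ^ p := by
          have := freqNorm_le ξ
          have h2 := norm_nonneg ξ
          have h3 : (0 : ℝ) ≤ N := by positivity
          gcongr
          nlinarith
      _ = _ := mul_pow _ _ _
  have hpos : 0 < (1 + ‖ξ‖) ^ (2 * N) := by positivity
  rw [norm_mul, ← div_eq_mul_inv, le_div_iff₀ hpos]
  calc ‖c t ξ‖ * ‖fourierCoef g ξ‖ * (1 + ‖ξ‖) ^ (2 * N)
      ≤ C * ((1 + N) ^ p * (1 + ‖ξ‖) ^ p) * ‖fourierCoef g ξ‖ * (1 + ‖ξ‖) ^ (2 * N) := by gcongr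
    _ = C * (1 + N) ^ p * ((1 + ‖ξ‖) ^ (p + 2 * N) * ‖fourierCoef g ξ‖) := by ring
    _ ≤ _ := by
      gcongr
      exact hD ξ

lemma fourierCoef_character (η ξ : Fin N → ℤ) :
    fourierCoef (character η) ξ = if ξ = η then 1 else 0 := by
  split_ifs with h
  · subst h
    have hp : ((2 * Real.pi) ^ N) ≠ 0 := (pow_pos Real.two_pi_pos N).ne'
    have (x : Fin N → ℝ) : character ξ x * character (-ξ) x = 1 := by
      rw [← character_add, add_neg_cancel, character_zero]
    simp only [fourierCoef, this]
    rw [MeasureTheory.setIntegral_const, volume_real_box, Complex.real_smul, mul_one,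
      ← Complex.ofReal_mul, inv_mul_cancel₀ hp, Complex.ofReal_one]
  -- Off the diagonal, compute the coefficient of the `j`-th derivative in two ways: it is both `i
  -- ξ_j` and `i η_j` times the original one.
  · obtain ⟨j, hj⟩ := Function.ne_iff.1 h
    have h1 := (smoothPeriodic_character η).fourierCoef_fderiv_single j ξ
    have h2 : fourierCoef (fun x => fderiv ℝ (character η) x (Pi.single j 1)) ξ
        = Complex.I * η j * fourierCoef (character η) ξ := by
      simp only [fderiv_character_single, fourierCoef]
      simp only [mul_assoc, MeasureTheory.integral_const_mul]
      ring
    rw [h2] at h1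
    have h3 : Complex.I * ((ξ j : ℂ) - η j) * fourierCoef (character η) ξ = 0 := by
      linear_combination -h1
    have h4 : (ξ j : ℂ) - η j ≠ 0 := by
      rw [sub_ne_zero]
      exact_mod_cast hj
    simpa [Complex.I_ne_zero, h4] using h3

lemma fourierCoef_tsum {ι : Type*} [Countable ι] {a : ι → ℂ} (ha : Summable fun i => ‖a i‖)
    (η : ι → Fin N → ℤ) (ξ : Fin N → ℤ) :
    fourierCoef (fun x => ∑' i, a i * character (η i) x) ξ
      = ∑' i, if ξ = η i then a i else 0 := by
  have h1 (i : ι) : (if ξ = η i then a i else 0) = (((2 * Real.pi) ^ N)⁻¹ : ℝ) *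
      ∫ x in box N, a i * character (η i) x * character (-ξ) x := by
    have := fourierCoef_character (η i) ξ
    rw [fourierCoef] at this
    simp only [mul_assoc, MeasureTheory.integral_const_mul]
    rw [mul_left_comm, this]
    simp
  simp only [h1, tsum_mul_left, fourierCoef]
  simp only [← tsum_mul_right]
  rw [← MeasureTheory.integral_tsum_of_summable_integral_norm]
  · intro i
    refine ContinuousOn.integrableOn_compact isCompact_Icc (Continuous.continuousOn ?_)
    exact (continuous_const.mul (contDiff_character _).continuous).mul
      (contDiff_character _).continuous
  · simp only [norm_mul, norm_character, mul_one, MeasureTheory.setIntegral_const, smul_eq_mul]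
    exact ha.mul_left _

lemma fourierCoef_tsum_self {ι : Type*} [Countable ι] {a : ι → ℂ}
    (ha : Summable fun i => ‖a i‖) {η : ι → Fin N → ℤ} (hη : Function.Injective η) (i : ι) :
    fourierCoef (fun x => ∑' i, a i * character (η i) x) (η i) = a i := by
  rw [fourierCoef_tsum ha, tsum_eq_single i]
  · simp
  · intro k hk
    simp [hη.eq_iff, hk.symm]

end FourierCoefficients

/-! ### Series of modes along the ray through `ξ₀`. -/

section Modes

variable {N : ℕ}

/-- The function `(t, x) ↦ a(t) e^{i x ξ}`. -/
def mode (a : ℝ → ℂ) (ξ : Fin N → ℤ) (p : ℝ × (Fin N → ℝ)) : ℂ := a p.1 * character ξ p.2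

lemma contDiff_mode {a : ℝ → ℂ} (ha : ContDiff ℝ ∞ a) (ξ : Fin N → ℤ) :
    ContDiff ℝ ∞ (mode a ξ) :=
  (ha.comp contDiff_fst).mul ((contDiff_character ξ).comp contDiff_snd)

lemma mode_periodic {a : ℝ → ℂ} (ha : Function.Periodic a (2 * Real.pi)) (ξ : Fin N → ℤ)
    (k : ℤ) (l : Fin N → ℤ) (t : ℝ) (x : Fin N → ℝ) :
    mode a ξ (t + 2 * Real.pi * k, fun j => x j + 2 * Real.pi * l j) = mode a ξ (t, x) := by
  rw [mode, mode, character_periodic]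
  simp only
  rw [mul_comm _ (k : ℝ), ha.int_mul k t]

lemma norm_iteratedFDeriv_comp_clm_le {E : Type*} [NormedAddCommGroup E] [NormedSpace ℝ E]
    {f : ℝ → ℂ} (hf : ContDiff ℝ ∞ f) (g : E →L[ℝ] ℝ) (k : ℕ) (x : E) :
    ‖iteratedFDeriv ℝ k (fun y => f (g y)) x‖ ≤ ‖iteratedDeriv k f (g x)‖ * ‖g‖ ^ k := by
  have := g.iteratedFDeriv_comp_right hf x (i := k) (by exact_mod_cast le_top)
  rw [Function.comp_def] at this
  rw [this, ← norm_iteratedFDeriv_eq_norm_iteratedDeriv (𝕜 := ℝ)]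
  exact (ContinuousMultilinearMap.norm_compContinuousLinearMap_le _ _).trans (by simp)

lemma norm_iteratedDeriv_cexp_I_mul (k : ℕ) (s : ℝ) :
    ‖iteratedDeriv k (fun s : ℝ => Complex.exp (Complex.I * s)) s‖ = 1 := by
  have h : iteratedDeriv k (fun s : ℝ => Complex.exp (Complex.I * s))
      = fun s : ℝ => Complex.I ^ k * Complex.exp (Complex.I * s) := by
    induction k with
    | zero => simp
    | succ k ih =>
      rw [iteratedDeriv_succ, ih]
      funext s
      have h1 : HasDerivAt (fun s : ℝ => Complex.I * (s : ℂ)) (Complex.I * 1) s :=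
        (Complex.ofRealCLM.hasDerivAt (x := s)).const_mul _
      rw [(h1.cexp.const_mul (Complex.I ^ k)).deriv]
      ring
  rw [h]
  simp only
  rw [mul_comm Complex.I, norm_mul, norm_pow, Complex.norm_I, one_pow,
    Complex.norm_exp_ofReal_mul_I, one_mul]

/-- Leibniz rule: a derivative falling on the character costs a factor `‖phase ξ‖`, which grows
linearly along the ray. -/
lemma norm_iteratedFDeriv_mode_le {a : ℝ → ℂ} (ha : ContDiff ℝ ∞ a) (ξ : Fin N → ℤ) (k : ℕ)
    (p : ℝ × (Fin N → ℝ)) :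
    ‖iteratedFDeriv ℝ k (mode a ξ) p‖ ≤ ∑ i ∈ Finset.range (k + 1),
      (k.choose i : ℝ) * ‖iteratedDeriv i a p.1‖ * ‖phase ξ‖ ^ (k - i) := by
  refine (norm_iteratedFDeriv_mul_le (ha.comp contDiff_fst)
    ((contDiff_character ξ).comp contDiff_snd) p (n := k) (by exact_mod_cast le_top)).trans ?_
  refine Finset.sum_le_sum fun i _ => ?_
  gcongr
  · refine (norm_iteratedFDeriv_comp_clm_le ha (ContinuousLinearMap.fst ℝ ℝ (Fin N → ℝ)) i p).trans
      ?_
    refine mul_le_of_le_one_right (norm_nonneg _) (pow_le_one₀ (norm_nonneg _) ?_)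
    exact ContinuousLinearMap.norm_fst_le _ _ _
  · have he : ContDiff ℝ ∞ (fun s : ℝ => Complex.exp (Complex.I * s)) :=
      (contDiff_const.mul Complex.ofRealCLM.contDiff).cexp
    have := norm_iteratedFDeriv_comp_clm_le he
      ((phase ξ).comp (ContinuousLinearMap.snd ℝ ℝ (Fin N → ℝ))) (k - i) p
    rw [norm_iteratedDeriv_cexp_I_mul, one_mul] at this
    have hEq : (character ξ ∘ Prod.snd : ℝ × (Fin N → ℝ) → ℂ) = fun y => Complex.exp (Complex.I *
        (((phase ξ).comp (ContinuousLinearMap.snd ℝ ℝ (Fin N → ℝ)) y : ℝ) : ℂ)) := by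
      funext y
      simp [character_eq]
    rw [hEq]
    refine this.trans ?_
    gcongr
    refine (ContinuousLinearMap.opNorm_comp_le _ _).trans ?_
    exact mul_le_of_le_one_right (norm_nonneg _) (ContinuousLinearMap.norm_snd_le _ _ _)

/-- The frequencies `(n + 1) ξ₀` on the ray through `ξ₀`. -/
def ray (ξ₀ : Fin N → ℤ) (n : ℕ) : Fin N → ℤ := ((n + 1 : ℕ) : ℤ) • ξ₀

lemma ray_injective {ξ₀ : Fin N → ℤ} (h : ξ₀ ≠ 0) : Function.Injective (ray ξ₀) := by
  intro a b hab
  have := smul_left_injective ℤ h hab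
  exact_mod_cast add_right_cancel (Int.natCast_inj.1 this)

lemma phase_ray (ξ₀ : Fin N → ℤ) (n : ℕ) : phase (ray ξ₀ n) = ((n : ℝ) + 1) • phase ξ₀ := by
  ext1 j
  simp only [phase_apply, ray, smul_apply, smul_eq_mul, Finset.mul_sum,
    Pi.smul_apply]
  push_cast
  exact Finset.sum_congr rfl fun j _ => by ring

/-- A sequence of smooth functions, all of whose derivatives decay rapidly and uniformly. -/
structure RapidlyDecreasing (a : ℕ → ℝ → ℂ) : Prop where
  smooth : ∀ n, ContDiff ℝ ∞ (a n)
  decay : ∀ k p : ℕ, ∃ C : ℝ, ∀ n t, ‖iteratedDeriv k (a n) t‖ * ((n : ℝ) + 1) ^ p ≤ C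

lemma summable_add_one_sq_inv : Summable fun n : ℕ => (((n : ℝ) + 1) ^ 2)⁻¹ := by
  have := (summable_nat_add_iff 1).2 (Real.summable_nat_pow_inv (p := 2).2 one_lt_two)
  simpa using this

lemma RapidlyDecreasing.summable {a : ℕ → ℝ → ℂ} (ha : RapidlyDecreasing a) (t : ℝ) :
    Summable fun n => ‖a n t‖ := by
  obtain ⟨C, hC⟩ := ha.decay 0 2
  refine Summable.of_nonneg_of_le (fun n => norm_nonneg _) (fun n => ?_)
    (summable_add_one_sq_inv.mul_left C)
  have := hC n t
  rw [iteratedDeriv_zero] at this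
  rw [← div_eq_mul_inv, le_div_iff₀ (by positivity)]
  exact this

lemma RapidlyDecreasing.exists_summable_bound {a : ℕ → ℝ → ℂ} (ha : RapidlyDecreasing a)
    (ξ₀ : Fin N → ℤ) (k : ℕ) :
    ∃ v : ℕ → ℝ, Summable v ∧ ∀ n p, ‖iteratedFDeriv ℝ k (mode (a n) (ray ξ₀ n)) p‖ ≤ v n := by
  -- The power `k - i` pays for the derivatives of the character, and `2` more make the series
  -- summable.
  choose C hC using fun i => ha.decay i (k - i + 2)
  refine ⟨fun n => (∑ i ∈ Finset.range (k + 1), (k.choose i : ℝ) * C i * ‖phase ξ₀‖ ^ (k - i))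
    * (((n : ℝ) + 1) ^ 2)⁻¹, summable_add_one_sq_inv.mul_left _, fun n p => ?_⟩
  refine (norm_iteratedFDeriv_mode_le (ha.smooth n) _ k p).trans ?_
  simp only [Finset.sum_mul]
  refine Finset.sum_le_sum fun i _ => ?_
  have hn : (0 : ℝ) < (n : ℝ) + 1 := by positivity
  rw [phase_ray, norm_smul, Real.norm_of_nonneg hn.le, ← div_eq_mul_inv,
    le_div_iff₀ (by positivity)]
  calc (k.choose i : ℝ) * ‖iteratedDeriv i (a n) p.1‖ * (((n : ℝ) + 1) * ‖phase ξ₀‖) ^ (k - i)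
        * ((n : ℝ) + 1) ^ 2
      = (k.choose i : ℝ) * (‖iteratedDeriv i (a n) p.1‖ * ((n : ℝ) + 1) ^ (k - i + 2))
        * ‖phase ξ₀‖ ^ (k - i) := by rw [mul_pow]; ring
    _ ≤ _ := by
      gcongr
      exact hC i n p.1

/-- The function `∑ a_n(t) e^{i (n + 1) x ξ₀}` over `n < M`. -/
def partialSum (a : ℕ → ℝ → ℂ) (ξ₀ : Fin N → ℤ) (hs : ∀ n, ContDiff ℝ ∞ (a n))
    (hp : ∀ n, Function.Periodic (a n) (2 * Real.pi)) (M : ℕ) : SmoothFun N where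
  toFun p := ∑ n ∈ Finset.range M, mode (a n) (ray ξ₀ n) p
  smooth := ContDiff.sum fun n _ => contDiff_mode (hs n) _
  periodic k l t x := Finset.sum_congr rfl fun n _ => mode_periodic (hp n) _ k l t x

/-- The function `∑ a_n(t) e^{i (n + 1) x ξ₀}` for rapidly decreasing coefficients. -/
def modeSeries (a : ℕ → ℝ → ℂ) (ξ₀ : Fin N → ℤ) (ha : RapidlyDecreasing a)
    (hp : ∀ n, Function.Periodic (a n) (2 * Real.pi)) : SmoothFun N where
  toFun p := ∑' n, mode (a n) (ray ξ₀ n) p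
  smooth := by
    choose v hv hb using ha.exists_summable_bound ξ₀
    exact contDiff_tsum (N := ⊤) (fun n => contDiff_mode (ha.smooth n) _) (fun k _ => hv k)
      fun k n p _ => hb k n p
  periodic k l t x := tsum_congr fun n => mode_periodic (hp n) _ k l t x

/-- The topology is an infimum over derivative orders, so the Weierstrass M-test for each order
suffices. -/
lemma tendsto_partialSum (a : ℕ → ℝ → ℂ) (ξ₀ : Fin N → ℤ) (ha : RapidlyDecreasing a)
    (hp : ∀ n, Function.Periodic (a n) (2 * Real.pi)) :
    Filter.Tendsto (partialSum a ξ₀ ha.smooth hp) Filter.atTop (𝓝 (modeSeries a ξ₀ ha hp)) := by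
  rw [nhds_iInf, Filter.tendsto_iInf]
  intro k
  rw [nhds_induced, Filter.tendsto_comap_iff, UniformFun.tendsto_iff_tendstoUniformly]
  choose v hv hb using ha.exists_summable_bound ξ₀
  have h := tendstoUniformly_tsum_nat (hv k) (hb k)
  have h1 : iteratedFDeriv ℝ k (modeSeries a ξ₀ ha hp).toFun
      = fun p => ∑' n, iteratedFDeriv ℝ k (mode (a n) (ray ξ₀ n)) p :=
    iteratedFDeriv_tsum (N := ⊤) (fun n => contDiff_mode (ha.smooth n) _) (fun k _ => hv k)
      (fun k n p _ => hb k n p) le_top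
  have h2 (M : ℕ) : iteratedFDeriv ℝ k (partialSum a ξ₀ ha.smooth hp M).toFun
      = fun p => ∑ n ∈ Finset.range M, iteratedFDeriv ℝ k (mode (a n) (ray ξ₀ n)) p :=
    by
    funext p
    change iteratedFDeriv ℝ k (fun q => ∑ n ∈ Finset.range M, mode (a n) (ray ξ₀ n) q) p = _
    exact iteratedFDeriv_fun_sum_apply fun n _ =>
      ((contDiff_mode (ha.smooth n) _).of_le (by exact_mod_cast le_top)).contDiffAt
  simp only [Function.comp_def, UniformFun.toFun_ofFun, h1, h2]
  exact h

/-- `P` acts on a finite sum of modes frequency by frequency. -/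
lemma operatorP_partialSum {c : ℝ → (Fin N → ℤ) → ℂ} {a f : ℕ → ℝ → ℂ} {ξ₀ : Fin N → ℤ}
    (has : ∀ n, ContDiff ℝ ∞ (a n))
    (hap : ∀ n, Function.Periodic (a n) (2 * Real.pi)) (hfs : ∀ n, ContDiff ℝ ∞ (f n))
    (hfp : ∀ n, Function.Periodic (f n) (2 * Real.pi))
    (h : ∀ n t, -Complex.I * deriv (a n) t + c t (ray ξ₀ n) * a n t = f n t) (M : ℕ) :
    operatorP c (partialSum a ξ₀ has hap M).toFun = (partialSum f ξ₀ hfs hfp M).toFun := by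
  funext ⟨t, x⟩
  have hd : deriv (fun s => (partialSum a ξ₀ has hap M).toFun (s, x)) t
      = ∑ n ∈ Finset.range M, deriv (a n) t * character (ray ξ₀ n) x := by
    change deriv (fun s => ∑ n ∈ Finset.range M, a n s * character (ray ξ₀ n) x) t = _
    refine HasDerivAt.deriv (HasDerivAt.fun_sum fun n _ => ?_)
    exact ((has n).differentiable (by simp) t).hasDerivAt.mul_const _
  have hF (ξ : Fin N → ℤ) : partialFourier (partialSum a ξ₀ has hap M).toFun t ξ
      = ∑ n ∈ Finset.range M, if ξ = ray ξ₀ n then a n t else 0 := by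
    have h1 := fourierCoef_tsum (ι := Fin M) (a := fun n => a n t)
      (hasSum_fintype _).summable (fun n => ray ξ₀ n) ξ
    simp only [tsum_fintype] at h1
    rw [partialFourier_eq, Finset.sum_range, ← h1]
    congr 1
    funext y
    simp [partialSum, mode, Finset.sum_range]
  have hQ : pseudoDiff c (partialSum a ξ₀ has hap M).toFun (t, x)
      = ∑ n ∈ Finset.range M, c t (ray ξ₀ n) * a n t * character (ray ξ₀ n) x := by
    have h1 (ξ : Fin N → ℤ) :
        c t ξ * (∑ n ∈ Finset.range M, if ξ = ray ξ₀ n then a n t else 0) * character ξ x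
          = ∑ n ∈ Finset.range M, if ξ = ray ξ₀ n
              then c t (ray ξ₀ n) * a n t * character (ray ξ₀ n) x else 0 := by
      rw [Finset.mul_sum, Finset.sum_mul]
      refine Finset.sum_congr rfl fun n _ => ?_
      split_ifs with h2
      · rw [h2]
      · simp
    simp only [pseudoDiff, hF, h1]
    exact (hasSum_sum fun n _ => hasSum_ite_eq _ _).tsum_eq
  rw [operatorP, hd, hQ, Finset.mul_sum, ← Finset.sum_add_distrib]
  refine Finset.sum_congr rfl fun n _ => ?_
  rw [mode, ← h n t]
  ring

end Modes

/-! ### Polynomially growing sequences of functions and their products with exponentials. -/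

section ModerateSequences

/-- A sequence of smooth functions, all of whose derivatives grow at most polynomially. -/
structure Moderate (G : ℕ → ℝ → ℂ) : Prop where
  smooth : ∀ n, ContDiff ℝ ∞ (G n)
  growth : ∀ k : ℕ, ∃ (C : ℝ) (p : ℕ), ∀ n t, ‖iteratedDeriv k (G n) t‖ ≤ C * ((n : ℝ) + 1) ^ p

lemma Moderate.exists_nonneg {G : ℕ → ℝ → ℂ} (hG : Moderate G) (k : ℕ) :
    ∃ (C : ℝ) (p : ℕ), 0 ≤ C ∧ ∀ n t, ‖iteratedDeriv k (G n) t‖ ≤ C * ((n : ℝ) + 1) ^ p := by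
  obtain ⟨C, p, h⟩ := hG.growth k
  exact ⟨C, p, by simpa using (norm_nonneg _).trans (h 0 0), h⟩

lemma Moderate.deriv {G : ℕ → ℝ → ℂ} (hG : Moderate G) : Moderate fun n => deriv (G n) where
  smooth n := (contDiff_infty_iff_deriv.1 (hG.smooth n)).2
  growth k := by
    simp only [← iteratedDeriv_succ']
    exact hG.growth (k + 1)

lemma Moderate.sub {G H : ℕ → ℝ → ℂ} (hG : Moderate G) (hH : Moderate H) :
    Moderate fun n t => G n t - H n t where
  smooth n := (hG.smooth n).sub (hH.smooth n)
  growth k := by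
    obtain ⟨C, p, hC, h⟩ := hG.exists_nonneg k
    obtain ⟨D, q, hD, h'⟩ := hH.exists_nonneg k
    refine ⟨C + D, p + q, fun n t => ?_⟩
    have hk : (k : ℕ∞ω) ≤ ∞ := by exact_mod_cast le_top
    rw [iteratedDeriv_fun_sub ((hG.smooth n).of_le hk).contDiffAt
      ((hH.smooth n).of_le hk).contDiffAt, add_mul]
    have h1 : (1 : ℝ) ≤ (n : ℝ) + 1 := by linarith [n.cast_nonneg (α := ℝ)]
    refine (norm_sub_le _ _).trans (add_le_add ((h n t).trans ?_) ((h' n t).trans ?_))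
    · gcongr
      all_goals first | exact h1 | omega
    · gcongr
      all_goals first | exact h1 | omega

lemma Moderate.mul {G H : ℕ → ℝ → ℂ} (hG : Moderate G) (hH : Moderate H) :
    Moderate fun n t => G n t * H n t where
  smooth n := (hG.smooth n).mul (hH.smooth n)
  growth k := by
    choose C p hC h using hG.exists_nonneg
    choose D q hD h' using hH.exists_nonneg
    refine ⟨∑ i ∈ Finset.range (k + 1), k.choose i * C i * D (k - i),
      ∑ i ∈ Finset.range (k + 1), (p i + q (k - i)), fun n t => ?_⟩
    have hk : (k : ℕ∞ω) ≤ ∞ := by exact_mod_cast le_top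
    rw [iteratedDeriv_fun_mul ((hG.smooth n).of_le hk).contDiffAt
      ((hH.smooth n).of_le hk).contDiffAt, Finset.sum_mul]
    refine (norm_sum_le _ _).trans (Finset.sum_le_sum fun i hi => ?_)
    have h1 : (1 : ℝ) ≤ (n : ℝ) + 1 := by linarith [n.cast_nonneg (α := ℝ)]
    rw [norm_mul, norm_mul, Complex.norm_natCast]
    calc (k.choose i : ℝ) * ‖iteratedDeriv i (G n) t‖ * ‖iteratedDeriv (k - i) (H n) t‖
        ≤ k.choose i * (C i * ((n : ℝ) + 1) ^ p i) * (D (k - i) * ((n : ℝ) + 1) ^ q (k - i)) := by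
          have := hC i
          have := h i n t
          have := h' (k - i) n t
          gcongr
      _ = k.choose i * C i * D (k - i) * ((n : ℝ) + 1) ^ (p i + q (k - i)) := by
          rw [pow_add]; ring
      _ ≤ _ := by
          have := hC i
          have := hD (k - i)
          have := Finset.single_le_sum (f := fun i => p i + q (k - i))
            (fun _ _ => Nat.zero_le _) hi
          gcongr

lemma moderate_const {κ : ℕ → ℂ} {C : ℝ} {p : ℕ} (h : ∀ n, ‖κ n‖ ≤ C * ((n : ℝ) + 1) ^ p) :
    Moderate fun n _ => κ n where
  smooth _ := contDiff_const
  growth k := by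
    refine ⟨C, p, fun n t => ?_⟩
    rw [iteratedDeriv_const]
    split_ifs
    · exact h n
    · simpa using (norm_nonneg _).trans (h n)

lemma moderate_of_periodic {g : ℝ → ℂ} (hg : ContDiff ℝ ∞ g)
    (hp : Function.Periodic g (2 * Real.pi)) : Moderate fun _ => g where
  smooth _ := hg
  growth k := by
    have h1 : Function.Periodic (iteratedDeriv k g) (2 * Real.pi) := fun t => by
      have := congrFun (iteratedDeriv_comp_add_const k g (2 * Real.pi)) t
      rw [← this]
      congr 1
      exact funext hp
    have h2 : Continuous (iteratedDeriv k g) :=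
      hg.continuous_iteratedDeriv k (by exact_mod_cast le_top)
    obtain ⟨C, hC⟩ := (h1.isBounded_of_continuous Real.two_pi_pos.ne' h2).exists_norm_le
    exact ⟨C, 0, fun n t => by simpa using hC _ ⟨t, rfl⟩⟩

lemma freqNorm_ray {N : ℕ} (ξ₀ : Fin N → ℤ) (n : ℕ) :
    freqNorm (ray ξ₀ n) = ((n : ℝ) + 1) * freqNorm ξ₀ := by
  have h : (0 : ℝ) ≤ (n : ℝ) + 1 := by positivity
  have h1 : ∑ j, (ray ξ₀ n j : ℝ) ^ 2 = ((n : ℝ) + 1) ^ 2 * ∑ j, (ξ₀ j : ℝ) ^ 2 := by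
    simp only [ray, Pi.smul_apply, smul_eq_mul, Finset.mul_sum]
    push_cast
    exact Finset.sum_congr rfl fun j _ => by ring
  rw [freqNorm, freqNorm, h1, Real.sqrt_mul (sq_nonneg _), Real.sqrt_sq h]

lemma IsSymbol.moderate {N : ℕ} {μ : ℝ} {c : ℝ → (Fin N → ℤ) → ℂ} (hc : IsSymbol μ c)
    (ξ₀ : Fin N → ℤ) : Moderate fun n t => c t (ray ξ₀ n) where
  smooth n := hc.smooth _
  growth k := by
    obtain ⟨C, hC0, hC⟩ := hc.bound k
    obtain ⟨p, hp⟩ := exists_nat_ge μ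
    refine ⟨C * (1 + freqNorm ξ₀) ^ p, p, fun n t => (hC t _).trans ?_⟩
    have h0 := freqNorm_nonneg ξ₀
    have hn : (0 : ℝ) ≤ n := n.cast_nonneg
    rw [mul_assoc, ← mul_pow, freqNorm_ray]
    gcongr
    have h1 : 1 ≤ 1 + ((n : ℝ) + 1) * freqNorm ξ₀ := le_add_of_nonneg_right (by positivity)
    refine (Real.rpow_le_rpow_of_exponent_le h1 hp).trans ?_
    rw [Real.rpow_natCast]
    gcongr
    nlinarith

/-- Derivatives of `G_n e^{-i A_n}` are of the form `H_n e^{-i A_n}` with `H_n` moderate. -/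
lemma Moderate.exists_iteratedDeriv_eq {A G : ℕ → ℝ → ℂ} {S : Set ℝ} (hS : IsClosed S)
    (hA : ∀ n, ContDiff ℝ ∞ (A n)) (hG : Moderate G)
    (hA' : Moderate fun n => _root_.deriv (A n)) (hGS : ∀ n, Function.support (G n) ⊆ S) (k : ℕ) :
    ∃ H : ℕ → ℝ → ℂ, Moderate H ∧ (∀ n, Function.support (H n) ⊆ S) ∧
      ∀ n, iteratedDeriv k (fun t => G n t * Complex.exp (-Complex.I * A n t))
        = fun t => H n t * Complex.exp (-Complex.I * A n t) := by
  induction k with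
  | zero => exact ⟨G, hG, hGS, fun n => iteratedDeriv_zero⟩
  | succ k ih =>
    obtain ⟨H, hH, hHS, h⟩ := ih
    -- The product rule turns `H` into `H' - i A' H`; closedness of `S` keeps the support of `H'`
    -- inside `S`.
    refine ⟨fun n t => _root_.deriv (H n) t - Complex.I * _root_.deriv (A n) t * H n t,
      hH.deriv.sub (((moderate_const (κ := fun _ => Complex.I) (C := 1) (p := 0)
        (by simp)).mul hA').mul hH), fun n t ht => ?_, fun n => ?_⟩
    · by_contra hS'
      have h1 : H n t = 0 := by
        by_contra h1
        exact hS' (hHS n h1)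
      have h2 : _root_.deriv (H n) t = 0 := by
        by_contra h2
        exact hS' (closure_minimal (hHS n) hS (support_deriv_subset h2))
      exact ht (by simp [h1, h2])
    · rw [iteratedDeriv_succ, h n]
      funext t
      have h1 : HasDerivAt (A n) (_root_.deriv (A n) t) t :=
        ((hA n).differentiable (by simp) t).hasDerivAt
      have h2 : HasDerivAt (H n) (_root_.deriv (H n) t) t :=
        ((hH.smooth n).differentiable (by simp) t).hasDerivAt
      refine (h2.mul (h1.const_mul (-Complex.I)).cexp).deriv.trans ?_
      ring

/-- Every derivative is a moderate factor supported in `S` times the same exponential, so decay of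
the exponential on `S` alone controls all orders. -/
lemma Moderate.rapidlyDecreasing {A G : ℕ → ℝ → ℂ} {S : Set ℝ} (hS : IsClosed S)
    (hA : ∀ n, ContDiff ℝ ∞ (A n)) (hG : Moderate G)
    (hA' : Moderate fun n => _root_.deriv (A n)) (hGS : ∀ n, Function.support (G n) ⊆ S)
    (hE : ∀ p : ℕ, ∃ C : ℝ, ∀ n, ∀ t ∈ S,
      ‖Complex.exp (-Complex.I * A n t)‖ * ((n : ℝ) + 1) ^ p ≤ C) :
    RapidlyDecreasing fun n t => G n t * Complex.exp (-Complex.I * A n t) where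
  smooth n := (hG.smooth n).mul (contDiff_const.mul (hA n)).cexp
  decay k p := by
    obtain ⟨H, hH, hHS, h⟩ := hG.exists_iteratedDeriv_eq hS hA hA' hGS k
    obtain ⟨C, q, hC, hb⟩ := hH.exists_nonneg 0
    obtain ⟨D, hD⟩ := hE (q + p)
    refine ⟨C * max D 0, fun n t => ?_⟩
    rw [h n]
    by_cases ht : H n t = 0
    · simp only [ht, zero_mul, norm_zero]
      positivity
    · have h1 := hb n t
      rw [iteratedDeriv_zero] at h1
      rw [norm_mul]
      calc ‖H n t‖ * ‖Complex.exp (-Complex.I * A n t)‖ * ((n : ℝ) + 1) ^ p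
          ≤ C * ((n : ℝ) + 1) ^ q * ‖Complex.exp (-Complex.I * A n t)‖ * ((n : ℝ) + 1) ^ p := by
            gcongr
        _ = C * (‖Complex.exp (-Complex.I * A n t)‖ * ((n : ℝ) + 1) ^ (q + p)) := by
            rw [pow_add]; ring
        _ ≤ _ := by
            gcongr
            exact (hD n t (hHS n ht)).trans (le_max_left _ _)

end ModerateSequences

/-! ### Comparison of the orders `m` and `m'` along a ray. -/

section Asymptotics

lemma tendsto_natCast_add_one : Filter.Tendsto (fun n : ℕ => (n : ℝ) + 1) .atTop .atTop :=
  Filter.tendsto_atTop_add_const_right _ _ tendsto_natCast_atTop_atTop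

/-- Lower order terms are negligible along a ray. -/
lemma eventually_lowerOrder_le {m m' : ℝ} (hm : 0 < m) (hm' : m' < m) {ε D ρ : ℝ} (hε : 0 < ε)
    (hD : 0 ≤ D) (hρ : 0 ≤ ρ) :
    ∀ᶠ n : ℕ in .atTop, D * (1 + ((n : ℝ) + 1) * ρ) ^ m' ≤ ε * ((n : ℝ) + 1) ^ m := by
  -- A nonnegative exponent makes the power monotone in its base; `m > 0` still gives `q < m`.
  set q := max m' 0
  have hq : 0 < m - q := sub_pos.2 (max_lt hm' hm)
  have h1 := ((tendsto_rpow_neg_atTop hq).comp tendsto_natCast_add_one).const_mul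
    (D * (1 + ρ) ^ q)
  rw [mul_zero] at h1
  filter_upwards [h1.eventually (gt_mem_nhds hε)] with n hn
  have hx : (1 : ℝ) ≤ (n : ℝ) + 1 := by linarith [n.cast_nonneg (α := ℝ)]
  have hx0 : (0 : ℝ) < (n : ℝ) + 1 := by linarith
  simp only [Function.comp_apply] at hn
  have h2 : 1 ≤ 1 + ((n : ℝ) + 1) * ρ := le_add_of_nonneg_right (by positivity)
  calc D * (1 + ((n : ℝ) + 1) * ρ) ^ m' ≤ D * (1 + ((n : ℝ) + 1) * ρ) ^ q := by
        have : m' ≤ q := le_max_left _ _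
        gcongr
    _ ≤ D * ((1 + ρ) * ((n : ℝ) + 1)) ^ q := by
        gcongr
        nlinarith
    _ = D * (1 + ρ) ^ q * ((n : ℝ) + 1) ^ (-(m - q)) * ((n : ℝ) + 1) ^ m := by
        rw [Real.mul_rpow (by positivity) hx0.le, mul_assoc (D * _), ← Real.rpow_add hx0]
        ring_nf
    _ ≤ _ := by gcongr

/-- Half of `ε (n + 1)^m` absorbs the lower order term; the other half beats the power `p`. -/
lemma exists_exp_mul_pow_le {m m' : ℝ} (hm : 0 < m) (hm' : m' < m) {ε D ρ : ℝ} (hε : 0 < ε)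
    (hD : 0 ≤ D) (hρ : 0 ≤ ρ) (p : ℕ) :
    ∃ C : ℝ, ∀ n : ℕ, Real.exp (-ε * ((n : ℝ) + 1) ^ m + D * (1 + ((n : ℝ) + 1) * ρ) ^ m')
      * ((n : ℝ) + 1) ^ p ≤ C := by
  -- The exponent `-p / m` becomes `-p` after substituting `(n + 1)^m`.
  have h1 := (isLittleO_exp_neg_mul_rpow_atTop (half_pos hε) (-(p : ℝ) / m)).comp_tendsto
    ((tendsto_rpow_atTop hm).comp tendsto_natCast_add_one)
  have h2 : ∀ᶠ n : ℕ in .atTop,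
      Real.exp (-ε * ((n : ℝ) + 1) ^ m + D * (1 + ((n : ℝ) + 1) * ρ) ^ m')
        * ((n : ℝ) + 1) ^ p ≤ 1 := by
    filter_upwards [h1.def one_pos, eventually_lowerOrder_le hm hm' (half_pos hε) hD hρ]
      with n hn hn'
    have hx : (0 : ℝ) < (n : ℝ) + 1 := by positivity
    simp only [Function.comp_apply, one_mul] at hn
    rw [← Real.rpow_mul hx.le, mul_div_cancel₀ _ hm.ne', Real.norm_of_nonneg (Real.exp_pos _).le,
      Real.norm_of_nonneg (by positivity), Real.rpow_neg hx.le, Real.rpow_natCast] at hn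
    have h3 : Real.exp (-ε * ((n : ℝ) + 1) ^ m + D * (1 + ((n : ℝ) + 1) * ρ) ^ m')
        ≤ (((n : ℝ) + 1) ^ p)⁻¹ := by
      refine (Real.exp_le_exp.2 ?_).trans hn
      linarith
    calc _ ≤ (((n : ℝ) + 1) ^ p)⁻¹ * ((n : ℝ) + 1) ^ p := by gcongr
      _ = 1 := inv_mul_cancel₀ (by positivity)
  obtain ⟨C, hC⟩ := (Filter.isBoundedUnder_of_eventually_le h2).bddAbove_range
  exact ⟨C, fun n => hC ⟨n, rfl⟩⟩

end Asymptotics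

/-! ### The peak of the primitive and cutoffs adapted to it. -/

section Cutoffs

/-- Around an interior maximum of the primitive of a sign-changing periodic function. -/
lemma exists_peak {β : ℝ → ℝ} (hβ : Continuous β) (hp : Function.Periodic β (2 * Real.pi))
    (hs : ChangesSign β) :
    ∃ mid d d' t₀ ε : ℝ, 0 ≤ d' ∧ d' < d ∧ d < Real.pi ∧ 0 < ε ∧ |t₀ - mid| ≤ d' ∧
      ∀ t, d' ≤ |t - mid| → |t - mid| ≤ d → ∫ s in t₀..t, β s ≤ -ε := by
  obtain ⟨⟨a₀, ha₀⟩, b, hb⟩ := hs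
  -- Take the negative point within one period after the positive point `b`. The endpoint `b + 2π`
  -- is excluded by sign, whence `d < π` below.
  obtain ⟨a, ⟨hba, hab⟩, haa⟩ := hp.exists_mem_Ioc Real.two_pi_pos a₀ b
  rw [haa] at ha₀
  replace hab : a < b + 2 * Real.pi := by
    refine hab.lt_of_ne fun h => ?_
    rw [h, hp b] at ha₀
    linarith
  set F : ℝ → ℝ := fun t => ∫ s in b..t, β s
  have hF (t : ℝ) : HasDerivAt F (β t) t := (hβ.integral_hasStrictDerivAt b t).hasDerivAt
  have hFc : Continuous F := continuous_iff_continuousAt.2 fun t => (hF t).continuousAt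
  -- `F` increases just after `b` and decreases just before `a`, so its maximum strictly exceeds
  -- both end values.
  obtain ⟨t₀, ht₀, hmax⟩ := (isCompact_Icc (a := b) (b := a)).exists_isMaxOn
    ⟨b, Set.left_mem_Icc.2 hba.le⟩ hFc.continuousOn
  have h1 : F b < F t₀ := by
    have h := ((hF b).tendsto_slope.mono_left
      (nhdsWithin_mono b (s := Set.Ioi b) fun x hx => ne_of_gt hx)).eventually (lt_mem_nhds hb)
    obtain ⟨t, ht, hbt, hta⟩ := (h.and (Ioo_mem_nhdsGT hba)).exists
    rw [slope_def_field, div_pos_iff_of_pos_right (sub_pos.2 hbt), sub_pos] at ht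
    exact ht.trans_le (hmax ⟨hbt.le, hta.le⟩)
  have h2 : F a < F t₀ := by
    have h := ((hF a).tendsto_slope.mono_left
      (nhdsWithin_mono a (s := Set.Iio a) fun x hx => ne_of_lt hx)).eventually (gt_mem_nhds ha₀)
    obtain ⟨t, ht, hbt, hta⟩ := (h.and (Ioo_mem_nhdsLT hba)).exists
    rw [slope_def_field, div_neg_iff] at ht
    have : F a < F t := by
      rcases ht with ht | ht <;> linarith
    exact this.trans_le (hmax ⟨hbt.le, hta.le⟩)
  set mid := (a + b) / 2
  set d := (a - b) / 2
  have hmb : mid - d = b := by simp only [mid, d]; ring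
  have hma : mid + d = a := by simp only [mid, d]; ring
  set ε := min (F t₀ - F b) (F t₀ - F a) / 2
  have hε : 0 < ε := half_pos (lt_min (sub_pos.2 h1) (sub_pos.2 h2))
  have hU : {s : ℝ | F (mid - s) < F t₀ - ε ∧ F (mid + s) < F t₀ - ε} ∈ 𝓝 d := by
    refine IsOpen.mem_nhds ?_ ?_
    · exact (isOpen_lt (hFc.comp (continuous_const.sub continuous_id)) continuous_const).inter
        (isOpen_lt (hFc.comp (continuous_const.add continuous_id)) continuous_const)
    · have h3 := min_le_left (F t₀ - F b) (F t₀ - F a)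
      have h4 := min_le_right (F t₀ - F b) (F t₀ - F a)
      simp only [Set.mem_ofPred_eq, hmb, hma]
      constructor <;> simp only [ε] at hε ⊢ <;> linarith
  -- By continuity the drop by `ε` persists for `|t - mid|` in `(l, d]`; `d'` will be the midpoint
  -- of `l` and `d`.
  obtain ⟨l, hl, hlU⟩ := exists_Ioc_subset_of_mem_nhds hU ⟨d - 1, by linarith⟩
  have ht₀d : |t₀ - mid| ≤ d := abs_le.2 ⟨by linarith [ht₀.1], by linarith [ht₀.2]⟩
  have key {t : ℝ} (h : |t - mid| ∈ Set.Ioc l d) : F t < F t₀ - ε := by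
    have h3 := hlU h
    rcases le_total 0 (t - mid) with h4 | h4
    · rw [abs_of_nonneg h4] at h3
      simpa using h3.2
    · rw [abs_of_nonpos h4] at h3
      simpa using h3.1
  have ht₀l : |t₀ - mid| ≤ l := by
    by_contra! h
    linarith [key ⟨h, ht₀d⟩]
  have hl0 : 0 ≤ l := (abs_nonneg _).trans ht₀l
  refine ⟨mid, d, (l + d) / 2, t₀, ε, by linarith, by linarith, ?_, hε, by linarith,
    fun t ht ht' => ?_⟩
  · simp only [d]; linarith
  · have h3 := key (t := t) ⟨by linarith, ht'⟩
    have h4 := intervalIntegral.integral_interval_sub_left (hβ.intervalIntegrable b t)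
      (hβ.intervalIntegrable (μ := MeasureTheory.volume) b t₀)
    rw [← h4]
    simp only [F] at h3
    linarith

/-- Both cutoffs are smooth functions of `cos (t - mid)`, hence periodic at once, and on a period
cosine levels correspond to distances from `mid`. The function `η` lives on the complementary arc,
nonempty because `d < π`. -/
lemma exists_cutoffs {mid d d' : ℝ} (h0 : 0 ≤ d') (h1 : d' < d) (h2 : d < Real.pi) :
    ∃ χ η : ℝ → ℝ, ContDiff ℝ ∞ χ ∧ ContDiff ℝ ∞ η ∧ Function.Periodic χ (2 * Real.pi) ∧
      Function.Periodic η (2 * Real.pi) ∧ (∀ t, |t - mid| ≤ d' → χ t = 1) ∧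
      (∀ t, |t - mid| ≤ d → η t = 0) ∧ (∀ t, χ t * η t = 0) ∧
      (∫ t in (0 : ℝ)..(2 * Real.pi), η t = 1) ∧
      ∀ t, deriv χ t ≠ 0 → Real.cos d ≤ Real.cos (t - mid) ∧ Real.cos (t - mid) ≤ Real.cos d' := by
  have hcos : Real.cos d < Real.cos d' := Real.cos_lt_cos_of_nonneg_of_le_pi h0 h2.le h1
  have hle {t r : ℝ} (hr : r ≤ Real.pi) (ht : |t - mid| ≤ r) : Real.cos r ≤ Real.cos (t - mid) := by
    rw [← Real.cos_abs (t - mid)]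
    exact Real.cos_le_cos_of_nonneg_of_le_pi (abs_nonneg _) hr ht
  have hper (t : ℝ) : Real.cos (t + 2 * Real.pi - mid) = Real.cos (t - mid) := by
    rw [← Real.cos_add_two_pi (t - mid)]
    ring_nf
  have hcc : Continuous fun t => Real.cos (t - mid) := by fun_prop
  set χ : ℝ → ℝ := fun t =>
    Real.smoothTransition ((Real.cos (t - mid) - Real.cos d) / (Real.cos d' - Real.cos d))
  set θ : ℝ → ℝ := fun t => Real.smoothTransition (Real.cos d - Real.cos (t - mid))
  have hχ : ContDiff ℝ ∞ χ := Real.smoothTransition.contDiff.comp (by fun_prop)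
  have hθ : ContDiff ℝ ∞ θ := Real.smoothTransition.contDiff.comp (by fun_prop)
  have hθp : Function.Periodic θ (2 * Real.pi) := fun t => by simp only [θ, hper]
  have hχ0 {t : ℝ} (ht : Real.cos (t - mid) ≤ Real.cos d) : χ t = 0 :=
    Real.smoothTransition.zero_of_nonpos (div_nonpos_of_nonpos_of_nonneg (by linarith)
      (by linarith))
  have hχ1 {t : ℝ} (ht : Real.cos d' ≤ Real.cos (t - mid)) : χ t = 1 :=
    Real.smoothTransition.one_of_one_le ((one_le_div (by linarith)).2 (by linarith))
  have hθ0 {t : ℝ} (ht : Real.cos d ≤ Real.cos (t - mid)) : θ t = 0 :=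
    Real.smoothTransition.zero_of_nonpos (by linarith)
  have hI : 0 < ∫ t in (0 : ℝ)..(2 * Real.pi), θ t := by
    have h3 := hθp.intervalIntegral_add_eq 0 mid
    rw [zero_add] at h3
    rw [h3]
    have hpi := Real.pi_pos
    refine intervalIntegral.integral_pos (by linarith) hθ.continuous.continuousOn
      (fun t _ => Real.smoothTransition.nonneg _)
      ⟨mid + Real.pi, ⟨by linarith, by linarith⟩, Real.smoothTransition.pos_of_pos ?_⟩
    rw [add_sub_cancel_left, sub_pos]
    exact Real.cos_lt_cos_of_nonneg_of_le_pi (h0.trans h1.le) le_rfl h2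
  refine ⟨χ, fun t => θ t / ∫ t in (0 : ℝ)..(2 * Real.pi), θ t, hχ, hθ.div_const _,
    fun t => by simp only [χ, hper], fun t => by simp only [hθp t],
    fun t ht => hχ1 (hle (by linarith) ht), fun t ht => by simp [hθ0 (hle h2.le ht)],
    fun t => ?_, ?_, fun t ht => ⟨?_, ?_⟩⟩
  · rcases le_total (Real.cos (t - mid)) (Real.cos d) with h | h
    · simp [hχ0 h]
    · simp [hθ0 h]
  · rw [intervalIntegral.integral_div, div_self hI.ne']
  · by_contra! h
    refine ht ?_
    have : χ =ᶠ[𝓝 t] fun _ => 0 :=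
      Filter.mem_of_superset ((isOpen_lt hcc continuous_const).mem_nhds h)
        fun s hs => hχ0 (le_of_lt hs)
    rw [this.deriv_eq, deriv_const]
  · by_contra! h
    refine ht ?_
    have : χ =ᶠ[𝓝 t] fun _ => 1 :=
      Filter.mem_of_superset ((isOpen_lt continuous_const hcc).mem_nhds h)
        fun s hs => hχ1 (le_of_lt hs)
    rw [this.deriv_eq, deriv_const]

/-- Every point of the circle has a representative within `π` of a given one. -/
lemma exists_int_abs_sub_le {mid d d' : ℝ} (h0 : 0 ≤ d') (h1 : d' < d) (h2 : d < Real.pi) {t : ℝ}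
    (ht : Real.cos d ≤ Real.cos (t - mid)) (ht' : Real.cos (t - mid) ≤ Real.cos d') :
    ∃ k : ℤ, d' ≤ |t + k * (2 * Real.pi) - mid| ∧ |t + k * (2 * Real.pi) - mid| ≤ d := by
  obtain ⟨k, ⟨hk, hk'⟩, -⟩ := existsUnique_add_zsmul_mem_Ioc Real.two_pi_pos t (mid - Real.pi)
  simp only [zsmul_eq_mul] at hk hk'
  have habs : |t + k * (2 * Real.pi) - mid| ∈ Set.Icc 0 Real.pi :=
    ⟨abs_nonneg _, abs_le.2 ⟨by linarith, by linarith⟩⟩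
  have hc : Real.cos |t + k * (2 * Real.pi) - mid| = Real.cos (t - mid) := by
    rw [Real.cos_abs, ← Real.cos_add_int_mul_two_pi (t - mid) k]
    ring_nf
  rw [← hc] at ht ht'
  exact ⟨k, (Real.strictAntiOn_cos.le_iff_ge habs ⟨h0, by linarith⟩).1 ht',
    (Real.strictAntiOn_cos.le_iff_ge ⟨by linarith, h2.le⟩ habs).1 ht⟩

end Cutoffs

/-! ### The ODEs along the ray and the equation on the Fourier side. -/

section Main

variable {N : ℕ}

lemma im_intervalIntegral {g : ℝ → ℂ} (hg : Continuous g) (a b : ℝ) :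
    (∫ s in a..b, g s).im = ∫ s in a..b, (g s).im :=
  (Complex.imCLM.intervalIntegral_comp_comm (hg.intervalIntegrable a b)).symm

lemma intervalIntegral_ray {m : ℝ} {bm : ℝ → (Fin N → ℤ) → ℝ} (hbm : IsPositivelyHomogeneous m bm)
    (ξ₀ : Fin N → ℤ) (n : ℕ) (a b : ℝ) :
    ∫ s in a..b, bm s (ray ξ₀ n) = ((n : ℝ) + 1) ^ m * ∫ s in a..b, bm s ξ₀ := by
  rw [← intervalIntegral.integral_const_mul]
  congr 1
  funext s
  rw [ray, hbm.homogeneous (n + 1) (by omega)]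
  push_cast
  rfl

/-- The primitive of a symbol along a ray, made periodic by subtracting a multiple of `η`. -/
def periodicPhase (c : ℝ → (Fin N → ℤ) → ℂ) (η : ℝ → ℝ) (ξ₀ : Fin N → ℤ) (t₀ : ℝ) (n : ℕ)
    (t : ℝ) : ℂ :=
  ∫ s in t₀..t, (c s (ray ξ₀ n) - (∫ r in (0 : ℝ)..(2 * Real.pi), c r (ray ξ₀ n)) * (η s : ℂ))

section PeriodicPhase

variable {μ : ℝ} {c : ℝ → (Fin N → ℤ) → ℂ} {η : ℝ → ℝ} {ξ₀ : Fin N → ℤ} {t₀ : ℝ}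

lemma contDiff_ofReal {g : ℝ → ℝ} (hg : ContDiff ℝ ∞ g) : ContDiff ℝ ∞ fun t => (g t : ℂ) :=
  Complex.ofRealCLM.contDiff.comp hg

lemma hasDerivAt_periodicPhase (hc : IsSymbol μ c) (hη : ContDiff ℝ ∞ η) (n : ℕ) (t : ℝ) :
    HasDerivAt (periodicPhase c η ξ₀ t₀ n)
      (c t (ray ξ₀ n) - (∫ r in (0 : ℝ)..(2 * Real.pi), c r (ray ξ₀ n)) * (η t : ℂ)) t :=
  (((hc.smooth (ray ξ₀ n)).continuous.sub (continuous_const.mul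
    (contDiff_ofReal hη).continuous)).integral_hasStrictDerivAt t₀ t).hasDerivAt

lemma contDiff_periodicPhase (hc : IsSymbol μ c) (hη : ContDiff ℝ ∞ η) (n : ℕ) :
    ContDiff ℝ ∞ (periodicPhase c η ξ₀ t₀ n) := by
  refine contDiff_infty_iff_deriv.2 ⟨fun t =>
    (hasDerivAt_periodicPhase hc hη n t).differentiableAt, ?_⟩
  rw [funext fun t => (hasDerivAt_periodicPhase (ξ₀ := ξ₀) (t₀ := t₀) hc hη n t).deriv]
  exact (hc.smooth _).sub (contDiff_const.mul (contDiff_ofReal hη))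

lemma moderate_deriv_periodicPhase (hc : IsSymbol μ c) (hη : ContDiff ℝ ∞ η)
    (hηp : Function.Periodic η (2 * Real.pi)) :
    Moderate fun n => deriv (periodicPhase c η ξ₀ t₀ n) := by
  have h : (fun n => deriv (periodicPhase c η ξ₀ t₀ n)) = fun n t => c t (ray ξ₀ n)
      - (∫ r in (0 : ℝ)..(2 * Real.pi), c r (ray ξ₀ n)) * (η t : ℂ) :=
    funext fun n => funext fun t => (hasDerivAt_periodicPhase hc hη n t).deriv
  rw [h]
  obtain ⟨C, p, hC⟩ := (hc.moderate ξ₀).growth 0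
  refine (hc.moderate ξ₀).sub ((moderate_const (C := C * (2 * Real.pi)) (p := p) fun n => ?_).mul
    (moderate_of_periodic (contDiff_ofReal hη) fun t => by rw [hηp]))
  refine (intervalIntegral.norm_integral_le_of_norm_le_const (C := C * ((n : ℝ) + 1) ^ p)
    fun t _ => by simpa using hC n t).trans (le_of_eq ?_)
  rw [sub_zero, abs_of_pos Real.two_pi_pos]
  ring

/-- Since `η` has integral `1`, the integrand has integral zero over a period. -/
lemma periodic_periodicPhase (hc : IsSymbol μ c) (hη : ContDiff ℝ ∞ η)
    (hηp : Function.Periodic η (2 * Real.pi)) (hI : ∫ t in (0 : ℝ)..(2 * Real.pi), η t = 1)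
    (n : ℕ) : Function.Periodic (periodicPhase c η ξ₀ t₀ n) (2 * Real.pi) := by
  intro t
  have hc' := (hc.smooth (ray ξ₀ n)).continuous
  have hη' := (contDiff_ofReal hη).continuous
  set κ := ∫ r in (0 : ℝ)..(2 * Real.pi), c r (ray ξ₀ n) with hκ
  have hκη : Continuous fun s => κ * (η s : ℂ) := continuous_const.mul hη'
  have hg : Continuous fun s => c s (ray ξ₀ n) - κ * (η s : ℂ) := hc'.sub hκη
  have hgp : Function.Periodic (fun s => c s (ray ξ₀ n) - κ * (η s : ℂ)) (2 * Real.pi) :=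
    fun s => by simp only [hc.periodic, hηp s]
  have h1 : ∫ s in t..t + 2 * Real.pi, (c s (ray ξ₀ n) - κ * (η s : ℂ)) = 0 := by
    rw [hgp.intervalIntegral_add_eq t 0, zero_add, intervalIntegral.integral_sub
      (hc'.intervalIntegrable _ _) (hκη.intervalIntegrable _ _),
      intervalIntegral.integral_const_mul, intervalIntegral.integral_ofReal, hI, ← hκ]
    simp
  rw [periodicPhase, periodicPhase, ← hκ,
    ← intervalIntegral.integral_add_adjacent_intervals (hg.intervalIntegrable t₀ t)
      (hg.intervalIntegrable t _), h1, add_zero]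

/-- On the arc carrying the peak the correction by `η` is invisible, so `exists_peak` applies to the
phase there. -/
lemma periodicPhase_eq {mid d : ℝ} (hη0 : ∀ t, |t - mid| ≤ d → η t = 0) (ht₀ : |t₀ - mid| ≤ d)
    {t : ℝ} (ht : |t - mid| ≤ d) (n : ℕ) :
    periodicPhase c η ξ₀ t₀ n t = ∫ s in t₀..t, c s (ray ξ₀ n) := by
  refine intervalIntegral.integral_congr fun s hs => ?_
  have h : s ∈ Metric.closedBall mid d := (convex_closedBall mid d).ordConnected.uIcc_subset
    (by simpa [Real.dist_eq] using ht₀) (by simpa [Real.dist_eq] using ht) hs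
  rw [Metric.mem_closedBall, Real.dist_eq] at h
  simp [hη0 s h]

end PeriodicPhase

/-- Amplitudes `a_n` along the ray which grow at a point although `(D_t + c) a_n` decays rapidly. -/
lemma exists_amplitudes {μ m m' : ℝ} {c : ℝ → (Fin N → ℤ) → ℂ} {bm b' : ℝ → (Fin N → ℤ) → ℝ}
    (hc : IsSymbol μ c) (hm : 0 < m) (hm' : m' < m) (hbm : IsPositivelyHomogeneous m bm)
    (hb' : IsSymbol m' b') (hb : ∀ t ξ, (c t ξ).im = bm t ξ + b' t ξ) (ξ₀ : Fin N → ℤ)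
    (hsign : ChangesSign fun t => bm t ξ₀) :
    ∃ (a f : ℕ → ℝ → ℂ) (t₀ : ℝ), (∀ n, ContDiff ℝ ∞ (a n)) ∧
      (∀ n, Function.Periodic (a n) (2 * Real.pi)) ∧ RapidlyDecreasing f ∧
      (∀ n, Function.Periodic (f n) (2 * Real.pi)) ∧
      (∀ n t, -Complex.I * deriv (a n) t + c t (ray ξ₀ n) * a n t = f n t) ∧
      ∀ n : ℕ, a n t₀ = (n : ℂ) + 1 := by
  obtain ⟨mid, d, d', t₀, ε, hd0, hd', hd, hε, ht₀, hpeak⟩ :=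
    exists_peak (hbm.isSymbol.smooth ξ₀).continuous (fun t => hbm.isSymbol.periodic t ξ₀) hsign
  obtain ⟨χ, η, hχ, hη, hχp, hηp, hχ1, hη0, hχη, hI, hχ'⟩ := exists_cutoffs (mid := mid) hd0 hd' hd
  set A := periodicPhase c η ξ₀ t₀
  have hA := contDiff_periodicPhase (ξ₀ := ξ₀) (t₀ := t₀) hc hη
  have hAp := periodic_periodicPhase (ξ₀ := ξ₀) (t₀ := t₀) hc hη hηp hI
  have hχC := contDiff_ofReal hχ
  have hχd (t : ℝ) : HasDerivAt (fun s => (χ s : ℂ)) ((deriv χ t : ℝ) : ℂ) t :=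
    ((hχ.differentiable (by simp) t).hasDerivAt).ofReal_comp
  have hχCp : Function.Periodic (fun t => (χ t : ℂ)) (2 * Real.pi) := fun t => by simp only [hχp t]
  have hχ'p : Function.Periodic (deriv χ) (2 * Real.pi) := fun t => by
    rw [← deriv_comp_add_const, funext hχp]
  set S : Set ℝ := {t | Real.cos d ≤ Real.cos (t - mid) ∧ Real.cos (t - mid) ≤ Real.cos d'}
  have hcc : Continuous fun t => Real.cos (t - mid) := by fun_prop
  have hS : IsClosed S := (isClosed_le continuous_const hcc).inter (isClosed_le hcc continuous_const)
  have hmod : Moderate fun n t => -Complex.I * ((n : ℂ) + 1) * ((deriv χ t : ℝ) : ℂ) := by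
    have h1 := moderate_of_periodic hχC hχCp
    have h2 : (fun t => ((deriv χ t : ℝ) : ℂ)) = deriv fun t => (χ t : ℂ) :=
      funext fun t => (hχd t).deriv.symm
    have h3 := h1.deriv
    rw [← h2] at h3
    refine (moderate_const (κ := fun n => -Complex.I * ((n : ℂ) + 1)) (C := 1) (p := 1)
      fun n => ?_).mul h3
    rw [norm_mul, norm_neg, Complex.norm_I, one_mul, one_mul, pow_one]
    exact_mod_cast (Complex.norm_natCast (n + 1)).le
  have hE : ∀ p : ℕ, ∃ C : ℝ, ∀ n, ∀ t ∈ S,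
      ‖Complex.exp (-Complex.I * A n t)‖ * ((n : ℝ) + 1) ^ p ≤ C := by
    intro p
    obtain ⟨B, hB0, hB⟩ := hb'.bound 0
    have hdpos : 0 < d := hd0.trans_lt hd'
    obtain ⟨C, hC⟩ := exists_exp_mul_pow_le hm hm' hε (D := B * (2 * d)) (by positivity)
      (freqNorm_nonneg ξ₀) p
    refine ⟨C, fun n t ht => le_trans ?_ (hC n)⟩
    -- Points of `S` are known only modulo `2π`; the periodicity of `A n` allows moving to the
    -- representative near `mid`.
    obtain ⟨k, hk, hk'⟩ := exists_int_abs_sub_le hd0 hd' hd ht.1 ht.2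
    set t' := t + k * (2 * Real.pi)
    have ht₀d : |t₀ - mid| ≤ d := ht₀.trans hd'.le
    have hAt : A n t = ∫ s in t₀..t', c s (ray ξ₀ n) := by
      rw [← periodicPhase_eq hη0 ht₀d hk' n]
      exact ((hAp n).int_mul k t).symm
    gcongr
    rw [Complex.norm_exp]
    gcongr
    have h1 : (-Complex.I * A n t).re = (A n t).im := by simp
    have hbmc := (hbm.isSymbol.smooth (ray ξ₀ n)).continuous
    have hbc := (hb'.smooth (ray ξ₀ n)).continuous
    rw [h1, hAt, im_intervalIntegral (hc.smooth _).continuous]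
    simp only [hb]
    rw [intervalIntegral.integral_add (hbmc.intervalIntegrable _ _)
      (hbc.intervalIntegrable _ _), intervalIntegral_ray hbm]
    refine add_le_add ?_ ?_
    · rw [mul_comm]
      gcongr
      exact hpeak t' hk hk'
    · refine (le_abs_self _).trans ?_
      rw [← Real.norm_eq_abs]
      refine (intervalIntegral.norm_integral_le_of_norm_le_const
        (C := B * (1 + ((n : ℝ) + 1) * freqNorm ξ₀) ^ m') fun s _ => ?_).trans ?_
      · rw [← freqNorm_ray]
        simpa using hB s (ray ξ₀ n)
      -- Both points lie within `d` of `mid`; this is the `2 * d` in the constant `D`.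
      · have h2 : |t' - t₀| ≤ 2 * d := by
          have := abs_sub_le t' mid t₀
          rw [abs_sub_comm mid] at this
          linarith
        have h3 : 0 ≤ (1 + ((n : ℝ) + 1) * freqNorm ξ₀) ^ m' := by
          have := freqNorm_nonneg ξ₀
          positivity
        calc _ ≤ B * (1 + ((n : ℝ) + 1) * freqNorm ξ₀) ^ m' * (2 * d) := by gcongr
          _ = _ := by ring
  refine ⟨fun n t => ((n : ℂ) + 1) * χ t * Complex.exp (-Complex.I * A n t),
    fun n t => -Complex.I * ((n : ℂ) + 1) * ((deriv χ t : ℝ) : ℂ) * Complex.exp (-Complex.I * A n t), t₀,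
    fun n => (contDiff_const.mul hχC).mul (contDiff_const.mul (hA n)).cexp,
    fun n t => ?_, hmod.rapidlyDecreasing hS hA (moderate_deriv_periodicPhase hc hη hηp)
      (fun n t ht => hχ' t fun h0 => ht (by simp [h0])) hE, fun n t => ?_, fun n t => ?_,
    fun n => ?_⟩
  · simp only [hχp t, A, hAp n t]
  · simp only [hχ'p t, A, hAp n t]
  · have h1 := ((hχd t).const_mul ((n : ℂ) + 1)).mul
      ((hasDerivAt_periodicPhase (ξ₀ := ξ₀) (t₀ := t₀) hc hη n t).const_mul (-Complex.I)).cexp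
    -- Disjointness of `χ` and `η` kills the periodising correction in the equation, leaving only
    -- the `χ'` term.
    have h2 : (χ t : ℂ) * η t = 0 := by exact_mod_cast hχη t
    refine (congrArg (fun z => -Complex.I * z + _) h1.deriv).trans ?_
    simp only [A]
    linear_combination (((n : ℂ) + 1) * Complex.exp (-Complex.I * periodicPhase c η ξ₀ t₀ n t)) *
      ((∫ r in (0 : ℝ)..(2 * Real.pi), c r (ray ξ₀ n)) * -Complex.I ^ 2 * h2 +
        c t (ray ξ₀ n) * χ t * Complex.I_sq)
  · simp [hχ1 t₀ ht₀, A, periodicPhase]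

/-- A linear equation `w' = -i q w` has no periodic solution besides zero if the mean of `Im q` is
not zero. -/
lemma eq_zero_of_periodic {q w : ℝ → ℂ} (hq : Continuous q)
    (hw : ∀ t, HasDerivAt w (-Complex.I * q t * w t) t) (hp : Function.Periodic w (2 * Real.pi))
    (hI : ∫ t in (0 : ℝ)..(2 * Real.pi), (q t).im ≠ 0) (t : ℝ) : w t = 0 := by
  set Q : ℝ → ℂ := fun t => ∫ s in (0 : ℝ)..t, q s
  have hQ (t : ℝ) : HasDerivAt Q (q t) t := (hq.integral_hasStrictDerivAt 0 t).hasDerivAt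
  have hg (t : ℝ) : HasDerivAt (fun t => w t * Complex.exp (Complex.I * Q t)) 0 t := by
    refine ((hw t).mul ((hQ t).const_mul Complex.I).cexp).congr_deriv ?_
    ring
  have hconst := is_const_of_deriv_eq_zero (fun t => (hg t).differentiableAt) fun t => (hg t).deriv
  have h0 : w 0 = 0 := by
    by_contra hne
    have h1 := hconst (2 * Real.pi) 0
    have h2 := hp 0
    rw [zero_add] at h2
    simp only [h2] at h1
    -- A nonzero periodic solution forces `exp(i Q(2π)) = exp(i Q(0))`; taking moduli gives zero
    -- mean of `Im q`.
    have h3 := mul_left_cancel₀ hne h1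
    have h4 := congrArg norm h3
    have h5 : (Q (2 * Real.pi)).im = 0 := by
      simpa [Complex.norm_exp, Q] using h4
    rw [im_intervalIntegral hq] at h5
    exact hI h5
  have h1 := hconst t 0
  simp only [h0, zero_mul] at h1
  exact (mul_eq_zero.1 h1).resolve_right (Complex.exp_ne_zero _)

lemma SmoothFun.hasDerivAt_slice (u : SmoothFun N) (t : ℝ) (x : Fin N → ℝ) :
    HasDerivAt (fun s => u.toFun (s, x)) (fderiv ℝ u.toFun (t, x) (1, 0)) t :=
  (u.smooth.differentiable (by simp) (t, x)).hasFDerivAt.comp_hasDerivAt t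
    ((hasDerivAt_id t).prodMk (hasDerivAt_const t x))

lemma SmoothFun.continuous_fderiv_time (u : SmoothFun N) :
    Continuous fun p => fderiv ℝ u.toFun p (1, 0) :=
  (u.smooth.continuous_fderiv (by simp)).clm_apply continuous_const

/-- Differentiation under the integral, dominated by the bound of the time derivative on `[t - 1, t
+ 1]` times the box. -/
lemma SmoothFun.hasDerivAt_partialFourier (u : SmoothFun N) (t : ℝ) (ξ : Fin N → ℤ) :
    HasDerivAt (fun s => partialFourier u.toFun s ξ)
      (fourierCoef (fun x => fderiv ℝ u.toFun (t, x) (1, 0)) ξ) t := by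
  have hu' := u.continuous_fderiv_time
  have hch := (contDiff_character (-ξ)).continuous
  obtain ⟨C, hC⟩ := ((isCompact_Icc (a := t - 1) (b := t + 1)).prod
    (isCompact_Icc (a := (0 : Fin N → ℝ)) (b := fun _ => 2 * Real.pi))
    ).exists_bound_of_continuousOn hu'.continuousOn
  refine ((hasDerivAt_integral_of_dominated_loc_of_deriv_le
    (μ := MeasureTheory.volume.restrict (box N)) (bound := fun _ => C)
    (F := fun s x => u.toFun (s, x) * character (-ξ) x)
    (F' := fun s x => fderiv ℝ u.toFun (s, x) (1, 0) * character (-ξ) x)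
    (Icc_mem_nhds (by linarith : t - 1 < t) (by linarith : t < t + 1))
    (Filter.Eventually.of_forall fun s => ?_) ?_ ?_ ?_ ?_ ?_).2).const_mul _
  · exact ((u.smooth.continuous.comp (by fun_prop)).mul hch).aestronglyMeasurable
  · exact ((u.smooth.continuous.comp (by fun_prop)).mul hch).continuousOn.integrableOn_compact
      isCompact_Icc
  · exact ((hu'.comp (by fun_prop)).mul hch).aestronglyMeasurable
  · filter_upwards [MeasureTheory.ae_restrict_mem measurableSet_Icc] with x hx s hs
    rw [norm_mul, norm_character, mul_one]
    exact hC (s, x) ⟨hs, hx⟩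
  · exact continuousOn_const.integrableOn_compact isCompact_Icc
  · exact Filter.Eventually.of_forall fun x s _ => (u.hasDerivAt_slice s x).mul_const _

/-- The equation `P u = f` on the side of partial Fourier coefficients. -/
lemma hasDerivAt_partialFourier_of_operatorP_eq {μ : ℝ} {c : ℝ → (Fin N → ℤ) → ℂ}
    (hc : IsSymbol μ c) {u f : SmoothFun N} (h : operatorP c u.toFun = f.toFun) (t : ℝ)
    (ξ : Fin N → ℤ) :
    HasDerivAt (fun s => partialFourier u.toFun s ξ) (-Complex.I * c t ξ *
      partialFourier u.toFun t ξ + Complex.I * partialFourier f.toFun t ξ) t := by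
  have h1 := fourierCoef_tsum_self (hc.summable_mul_fourierCoef (u.smoothPeriodic t) t)
    (η := id) Function.injective_id ξ
  have h2 : (fun x => ∑' η : Fin N → ℤ, c t η * fourierCoef (fun x => u.toFun (t, x)) η
      * character η x) = fun x => f.toFun (t, x)
        + Complex.I * fderiv ℝ u.toFun (t, x) (1, 0) := by
    funext x
    have h3 := congrFun h (t, x)
    rw [operatorP, (u.hasDerivAt_slice t x).deriv] at h3
    rw [← h3, pseudoDiff]
    simp only [partialFourier_eq]
    ring
  simp only [id] at h1
  rw [h2] at h1
  have hch := (contDiff_character (-ξ)).continuous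
  have h4 : fourierCoef (fun x => f.toFun (t, x) + Complex.I * fderiv ℝ u.toFun (t, x) (1, 0)) ξ
      = partialFourier f.toFun t ξ
        + Complex.I * fourierCoef (fun x => fderiv ℝ u.toFun (t, x) (1, 0)) ξ := by
    rw [partialFourier_eq, fourierCoef, fourierCoef, fourierCoef]
    simp only [add_mul, mul_assoc]
    rw [MeasureTheory.integral_add, MeasureTheory.integral_const_mul]
    · ring
    · exact ((f.smooth.continuous.comp (by fun_prop)).mul hch).continuousOn.integrableOn_compact
        isCompact_Icc
    · exact (continuous_const.mul ((u.continuous_fderiv_time.comp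
        (by fun_prop)).mul hch)).continuousOn.integrableOn_compact isCompact_Icc
  convert u.hasDerivAt_partialFourier t ξ using 1
  rw [h4, ← partialFourier_eq] at h1
  linear_combination Complex.I * h1 -
    fourierCoef (fun x => fderiv ℝ u.toFun (t, x) (1, 0)) ξ * Complex.I_sq

/-- The mean of `b_m` scales like `(n + 1)^m`, and the contribution of `b'` is eventually at most
half of it. -/
lemma eventually_mean_im_ne_zero {m m' : ℝ} {c : ℝ → (Fin N → ℤ) → ℂ}
    {bm b' : ℝ → (Fin N → ℤ) → ℝ} (hm : 0 < m) (hm' : m' < m)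
    (hbm : IsPositivelyHomogeneous m bm) (hb' : IsSymbol m' b')
    (hb : ∀ t ξ, (c t ξ).im = bm t ξ + b' t ξ) (ξ₀ : Fin N → ℤ)
    (havg : ∫ t in (0 : ℝ)..(2 * Real.pi), bm t ξ₀ ≠ 0) :
    ∀ᶠ n : ℕ in .atTop, ∫ t in (0 : ℝ)..(2 * Real.pi), (c t (ray ξ₀ n)).im ≠ 0 := by
  obtain ⟨B, hB0, hB⟩ := hb'.bound 0
  have hpos := abs_pos.2 havg
  have hpi := Real.two_pi_pos
  filter_upwards [eventually_lowerOrder_le hm hm' (half_pos hpos) (D := B * (2 * Real.pi))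
    (by positivity) (freqNorm_nonneg ξ₀)] with n hn h0
  have hbmc := (hbm.isSymbol.smooth (ray ξ₀ n)).continuous
  have hbc := (hb'.smooth (ray ξ₀ n)).continuous
  simp only [hb] at h0
  rw [intervalIntegral.integral_add (hbmc.intervalIntegrable _ _)
    (hbc.intervalIntegrable _ _), intervalIntegral_ray hbm] at h0
  have h1 := intervalIntegral.norm_integral_le_of_norm_le_const (a := 0) (b := 2 * Real.pi)
    (f := fun s => b' s (ray ξ₀ n)) (C := B * (1 + ((n : ℝ) + 1) * freqNorm ξ₀) ^ m')
    fun s _ => by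
      rw [← freqNorm_ray]
      simpa using hB s (ray ξ₀ n)
  have hx : 0 < ((n : ℝ) + 1) ^ m := by positivity
  rw [eq_neg_of_add_eq_zero_right h0, norm_neg, norm_mul, Real.norm_of_nonneg hx.le,
    Real.norm_eq_abs, sub_zero, abs_of_pos hpi] at h1
  nlinarith [mul_pos hx hpos]

end Main

end TorusPDO

end

theorem mainTheorem5 (N : ℕ) (μ m m' : ℝ)
    (c : ℝ → (Fin N → ℤ) → ℂ) (bm b' : ℝ → (Fin N → ℤ) → ℝ)
    (hc : TorusPDO.IsSymbol μ c)
    (hm : 0 < m) (hm' : m' < m)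
    (hbm : TorusPDO.IsPositivelyHomogeneous m bm)
    (hb' : TorusPDO.IsSymbol m' b')
    (hb : ∀ t ξ, (c t ξ).im = bm t ξ + b' t ξ)
    (ξ₀ : Fin N → ℤ) (hξ₀ : ξ₀ ≠ 0)
    (havg : (2 * Real.pi)⁻¹ * (∫ t in (0 : ℝ)..(2 * Real.pi), bm t ξ₀) ≠ 0)
    (hsign : TorusPDO.ChangesSign (fun t => bm t ξ₀)) :
    ¬ TorusPDO.IsGloballySolvable c := by
  open TorusPDO in
  intro hclosed
  obtain ⟨a, f, t₀, ha, hap, hf, hfp, haf, hat₀⟩ :=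
    exists_amplitudes hc hm hm' hbm hb' hb ξ₀ hsign
  -- The series of the `a n` need not converge, but only its finite sums are needed as preimages.
  obtain ⟨u, hu⟩ : modeSeries f ξ₀ hf hfp ∈ rangeP c :=
    hclosed.mem_of_tendsto (tendsto_partialSum f ξ₀ hf hfp) <| Filter.Eventually.of_forall fun M =>
      ⟨partialSum a ξ₀ ha hap M, operatorP_partialSum ha hap hf.smooth hfp haf M⟩
  obtain ⟨C, hC⟩ := (u.smoothPeriodic t₀).exists_bound
  obtain ⟨n, hn, hnC⟩ := ((eventually_mean_im_ne_zero hm hm' hbm hb' hb ξ₀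
    (right_ne_zero_of_mul havg)).and (Filter.eventually_ge_atTop ⌈C⌉₊)).exists
  have hfn (t : ℝ) : partialFourier (modeSeries f ξ₀ hf hfp).toFun t (ray ξ₀ n) = f n t :=
    fourierCoef_tsum_self (hf.summable t) (ray_injective hξ₀) n
  -- Both terms solve the same periodic ODE with right-hand side `f n`, so their difference solves
  -- the homogeneous one.
  have hw : partialFourier u.toFun t₀ (ray ξ₀ n) - a n t₀ = 0 := by
    refine eq_zero_of_periodic (q := fun t => c t (ray ξ₀ n))
      (w := fun t => partialFourier u.toFun t (ray ξ₀ n) - a n t) (hc.smooth _).continuous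
      (fun t => ?_) (fun t => ?_) hn t₀
    · have h1 := hasDerivAt_partialFourier_of_operatorP_eq hc hu t (ray ξ₀ n)
      rw [hfn] at h1
      refine (h1.sub ((ha n).differentiable (by simp) t).hasDerivAt).congr_deriv ?_
      linear_combination -Complex.I * haf n t - deriv (a n) t * Complex.I_sq
    · have h1 (x : Fin N → ℝ) : u.toFun (t + 2 * Real.pi, x) = u.toFun (t, x) := by
        simpa using u.periodic 1 0 t x
      simp only [hap n t, partialFourier, h1]
  -- The coefficient equals `n + 1`, yet it is at most `C ≤ n`.
  have h1 := norm_fourierCoef_le hC (ray ξ₀ n)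
  rw [← partialFourier_eq, sub_eq_zero.1 hw, hat₀] at h1
  have h2 : ‖(n : ℂ) + 1‖ = (n : ℝ) + 1 := by exact_mod_cast Complex.norm_natCast (n + 1)
  rw [h2] at h1
  linarith [Nat.ceil_le.1 hnC]
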